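/- Let $t\in[0,1]$. For $n\ge 1$, let $A_{n,t}$ be a random $n\times n$ matrix from the Elliptic Ginibre Ensemble, i.e. with the law of $$\sqrt{\tfrac{1+t}{2}}\,X_n+i\sqrt{\tfrac{1-t}{2}}\,Y_n ,$$ where $X_n,Y_n$ are independent matrices from the Gaussian Unitary Ensemble of size $n$, normalised so that the diagonal entries are real $N(0,1)$ variables and the entries above the diagonal are standard complex Gaussians ($\mathbb E[x^2]=0$, $\mathbb E|x|^2=1$), all of them independent. Let the modified Chebyshev polynomials be defined by $P^{(t)}_0=2$, $P^{(t)}_1=X$, $P^{(t)}_{k+1}=XP^{(t)}_k-tP^{(t)}_{k-1}$ for $k\ge1$, and for $k\ge 0$ put $$U^{(n)}_{k,t}=\mathrm{Tr}\Big[P^{(t)}_k\Big(\tfrac{A_{n,t}}{\sqrt n}\Big)\Big]+nt\,\delta_{k=2},\qquad V^{(n)}_{k,t}=U^{(n)}_{k,t}-\mathbb E\big[U^{(n)}_{k,t}\big].$$ Then all the $U^{(n)}_{k,t}$ are integrable and, as $n\to\infty$, the family $(V^{(n)}_{k,t})_{k\ge0}$ converges in law (jointly in $k$, as random elements of $\mathbb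 C^{\mathbb N}$ with the product topology) to a family $(V_{k,t})_{k\ge0}$ of independent centred complex Gaussian random variables (each $V_{k,t}$ being possibly degenerate, with $(\mathrm{Re}\,V_{k,t},\mathrm{Im}\,V_{k,t})$ jointly Gaussian) such that $\mathbb E[V_{k,t}^2]=kt^k$ and $\mathbb E[|V_{k,t}|^2]=k$ for all $k\ge 0$. -/

import Mathlib

open MeasureTheory ProbabilityTheory Filter

/-- The modified Chebyshev polynomials `P_k^{(t)}`, i.e. `P_0 = 2`, `P_1 = X` and
`P_{k+2} = X P_{k+1} - t P_k`. These are the Dickson polynomials of the first kind with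
parameter `t`; the recurrence is recorded in the three lemmas below. -/
noncomputable def modChebyshev (t : ℝ) (k : ℕ) : Polynomial ℂ :=
  Polynomial.dickson 1 (t : ℂ) k

theorem modChebyshev_zero (t : ℝ) : modChebyshev t 0 = 2 := by
  unfold modChebyshev
  rw [Polynomial.dickson_zero]
  norm_num

theorem modChebyshev_one (t : ℝ) : modChebyshev t 1 = Polynomial.X := by
  unfold modChebyshev
  rw [Polynomial.dickson_one]

theorem modChebyshev_add_two (t : ℝ) (k : ℕ) :
    modChebyshev t (k + 2) =
      Polynomial.X * modChebyshev t (k + 1) - Polynomial.C (t : ℂ) * modChebyshev t k := by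
  unfold modChebyshev
  rw [Polynomial.dickson_add_two]

/-- Matrices carry the product sigma-algebra of their entries. -/
instance instMeasurableSpaceMatrix {m n α : Type*} [MeasurableSpace α] :
    MeasurableSpace (Matrix m n α) :=
  inferInstanceAs (MeasurableSpace (m → n → α))

/-- The Hermitian matrix with diagonal entries `g i i` and, above the diagonal, entries
`(g i j + i g j i) / √2`. -/
noncomputable def gueMatrix (n : ℕ) (g : Fin n × Fin n → ℝ) : Matrix (Fin n) (Fin n) ℂ :=
  Matrix.of fun i j =>
    if i = j then (g (i, i) : ℂ)
    else if i < j then ((g (i, j) : ℂ) + Complex.I * (g (j, i) : ℂ)) / (Real.sqrt 2 : ℂ)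
    else ((g (j, i) : ℂ) - Complex.I * (g (i, j) : ℂ)) / (Real.sqrt 2 : ℂ)

theorem gueMatrix_isHermitian (n : ℕ) (g : Fin n × Fin n → ℝ) :
    (gueMatrix n g).IsHermitian := by
  ext i j
  rcases lt_trichotomy i j with h | h | h
  · simp [gueMatrix, Matrix.conjTranspose_apply, h, h.ne, h.ne', h.not_gt, sub_eq_add_neg]
  · subst h
    simp [gueMatrix, Matrix.conjTranspose_apply]
  · simp [gueMatrix, Matrix.conjTranspose_apply, h, h.ne, h.ne', h.not_gt, sub_eq_add_neg]

theorem measurable_gueMatrix (n : ℕ) : Measurable (gueMatrix n) := by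
  refine measurable_pi_lambda _ fun i => measurable_pi_lambda _ fun j => ?_
  simp only [gueMatrix, Matrix.of_apply]
  split_ifs <;> fun_prop

/-- The law of the Gaussian Unitary Ensemble of size `n`, with density proportional to
`exp (- Tr H ^ 2 / 2)` on Hermitian matrices: the diagonal entries are standard real Gaussians,
the entries above the diagonal are standard complex Gaussians, all of them independent. -/
noncomputable def gueLaw (n : ℕ) : Measure (Matrix (Fin n) (Fin n) ℂ) :=
  (Measure.pi fun _ : Fin n × Fin n => gaussianReal 0 1).map (gueMatrix n)

instance isProbabilityMeasure_gueLaw (n : ℕ) : IsProbabilityMeasure (gueLaw n) :=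
  Measure.isProbabilityMeasure_map (measurable_gueMatrix n).aemeasurable

/-- `√((1 + t) / 2) X + i √((1 - t) / 2) Y`. -/
noncomputable def ellipticCombination (n : ℕ) (t : ℝ)
    (p : Matrix (Fin n) (Fin n) ℂ × Matrix (Fin n) (Fin n) ℂ) : Matrix (Fin n) (Fin n) ℂ :=
  (Real.sqrt ((1 + t) / 2) : ℂ) • p.1 + (Complex.I * (Real.sqrt ((1 - t) / 2) : ℂ)) • p.2

theorem measurable_ellipticCombination (n : ℕ) (t : ℝ) :
    Measurable (ellipticCombination n t) := by
  refine measurable_pi_lambda _ fun i => measurable_pi_lambda _ fun j => ?_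
  have h1 : Measurable fun p : Matrix (Fin n) (Fin n) ℂ × Matrix (Fin n) (Fin n) ℂ => p.1 i j :=
    (measurable_pi_apply j).comp ((measurable_pi_apply i).comp measurable_fst)
  have h2 : Measurable fun p : Matrix (Fin n) (Fin n) ℂ × Matrix (Fin n) (Fin n) ℂ => p.2 i j :=
    (measurable_pi_apply j).comp ((measurable_pi_apply i).comp measurable_snd)
  simp only [ellipticCombination, Matrix.add_apply, Matrix.smul_apply, smul_eq_mul]
  exact (h1.const_mul _).add (h2.const_mul _)

/-- The law of the Elliptic Ginibre Ensemble of size `n` at `t`: the law of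
`√((1 + t) / 2) X + i √((1 - t) / 2) Y` with `X` and `Y` independent GUE matrices of size `n`. -/
noncomputable def ellipticGinibreLaw (n : ℕ) (t : ℝ) : Measure (Matrix (Fin n) (Fin n) ℂ) :=
  ((gueLaw n).prod (gueLaw n)).map (ellipticCombination n t)

instance isProbabilityMeasure_ellipticGinibreLaw (n : ℕ) (t : ℝ) :
    IsProbabilityMeasure (ellipticGinibreLaw n t) :=
  Measure.isProbabilityMeasure_map (measurable_ellipticCombination n t).aemeasurable

/-- `U_{k,t}^{(n)} = Tr P_k^{(t)} (M / √n) + n t δ_{k = 2}` as a function of the matrix `M`. -/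
noncomputable def traceStat (n : ℕ) (t : ℝ) (k : ℕ) (M : Matrix (Fin n) (Fin n) ℂ) : ℂ :=
  (Polynomial.aeval ((Real.sqrt n : ℂ)⁻¹ • M) (modChebyshev t k)).trace
    + if k = 2 then (n : ℂ) * (t : ℂ) else 0

/-- `V_{k,t}^{(n)} = U_{k,t}^{(n)} - E [U_{k,t}^{(n)}]` for a random matrix `A` of size `n`. -/
noncomputable def centredTrace {Ω : Type*} [MeasurableSpace Ω] (P : Measure Ω) (n : ℕ) (t : ℝ)
    (A : Ω → Matrix (Fin n) (Fin n) ℂ) (k : ℕ) (ω : Ω) : ℂ :=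
  traceStat n t k (A ω) - ∫ ω', traceStat n t k (A ω') ∂P

/-!
The matrix `A / √n` and its adjoint are linear in independent standard real Gaussian variables, so
Gaussian integration by parts expresses `E[Tr (A Z) G]`, for words `Z` in these matrices, through
shorter words. Iterating, all fluctuations of traces of words are bounded in every `L ^ p`,
normalised traces concentrate, and the Chebyshev polynomials of the second kind become biorthogonal
for the limiting normalised trace. Multiplying `A` by such a polynomial `U_k` produces the
Chebyshev polynomial `P_(k+1)` together with counterterms which the second half of the integration
by parts formula cancels. For a real linear combination `F` of the centred traces of the `P_k`, the
characteristic function `φ s = E[exp (i s F)]` therefore satisfies `φ' s = - s v φ s + o(1)`, with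
`v` the asymptotic variance, which is diagonal in `k` by biorthogonality.
-/

/-! # Gaussian integration by parts -/

theorem hasDerivAt_gaussianPDFReal (m : ℝ) (v : NNReal) (x : ℝ) :
    HasDerivAt (gaussianPDFReal m v) (-((x - m) / v) * gaussianPDFReal m v x) x := by
  have hexponent : HasDerivAt (fun y : ℝ => -(y - m) ^ 2 / (2 * v)) (-((x - m) / v)) x := by
    refine ((((hasDerivAt_id x).sub_const m).pow 2).neg.div_const (2 * (v : ℝ))).congr_deriv ?_
    simpa [neg_div] using mul_div_mul_left (x - m) (v : ℝ) two_ne_zero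
  rw [gaussianPDFReal_def]
  exact (hexponent.exp.const_mul _).congr_deriv (by ring)

theorem integrable_gaussianReal_iff {E : Type*} [NormedAddCommGroup E] [NormedSpace ℝ E]
    {m : ℝ} {v : NNReal} (hv : v ≠ 0) {f : ℝ → E} :
    Integrable f (gaussianReal m v) ↔ Integrable fun x => gaussianPDFReal m v x • f x := by
  rw [gaussianReal_of_var_ne_zero _ hv, integrable_withDensity_iff_integrable_smul'
    (measurable_gaussianPDF m v) (ae_of_all _ fun _ => gaussianPDF_lt_top)]
  simp only [toReal_gaussianPDF]

theorem integral_sub_smul_gaussianReal {E : Type*} [NormedAddCommGroup E] [NormedSpace ℝ E]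
    {m : ℝ} {v : NNReal} {f f' : ℝ → E} (hf : ∀ x, HasDerivAt f (f' x) x)
    (hf_int : Integrable f (gaussianReal m v)) (hf'_int : Integrable f' (gaussianReal m v))
    (hxf_int : Integrable (fun x => (x - m) • f x) (gaussianReal m v)) :
    ∫ x, (x - m) • f x ∂gaussianReal m v = (v : ℝ) • ∫ x, f' x ∂gaussianReal m v := by
  rcases eq_or_ne v 0 with rfl | hv
  · rw [NNReal.coe_zero, zero_smul, gaussianReal_zero_var]
    exact integral_eq_zero_of_ae (by simp [ae_dirac_eq, EventuallyEq])
  rw [integrable_gaussianReal_iff hv] at hf_int hf'_int hxf_int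
  have hderiv (x : ℝ) := (hasDerivAt_gaussianPDFReal m v x).smul (hf x)
  have hderiv_eq (x : ℝ) : gaussianPDFReal m v x • f' x +
      (-((x - m) / v) * gaussianPDFReal m v x) • f x =
      gaussianPDFReal m v x • f' x -
        (v : ℝ)⁻¹ • gaussianPDFReal m v x • (x - m) • f x := by
    module
  have hzero := integral_eq_zero_of_hasDerivAt_of_integrable hderiv
    ((hf'_int.sub (hxf_int.smul (v : ℝ)⁻¹)).congr (ae_of_all _ fun x => (hderiv_eq x).symm)) hf_int
  simp only [hderiv_eq] at hzero
  rw [integral_sub hf'_int (by exact hxf_int.smul (v : ℝ)⁻¹), integral_smul, sub_eq_zero,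
    ← integral_gaussianReal_eq_integral_smul hv, ← integral_gaussianReal_eq_integral_smul hv]
    at hzero
  rw [hzero, smul_inv_smul₀ (NNReal.coe_ne_zero.2 hv)]

theorem measurePreserving_update {ι : Type*} [Fintype ι] [DecidableEq ι] {α : ι → Type*}
    [∀ i, MeasurableSpace (α i)] (μ : ∀ i, Measure (α i)) [∀ i, SigmaFinite (μ i)] (i : ι)
    [IsProbabilityMeasure (μ i)] :
    MeasurePreserving (fun q : (∀ j, α j) × α i => Function.update q.1 i q.2)
      ((Measure.pi μ).prod (μ i)) (Measure.pi μ) := by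
  have hmeas : Measurable fun q : (∀ j, α j) × α i => Function.update q.1 i q.2 := by
    refine measurable_pi_lambda _ fun j => ?_
    rcases eq_or_ne j i with rfl | hj
    · simpa using measurable_snd
    · simp only [Function.update_of_ne hj]
      exact (measurable_pi_apply j).comp measurable_fst
  refine ⟨hmeas, (Measure.pi_eq fun s hs => ?_).symm⟩
  have hpreimage : (fun q : (∀ j, α j) × α i => Function.update q.1 i q.2) ⁻¹' Set.univ.pi s
      = Set.univ.pi (Function.update s i Set.univ) ×ˢ s i := by
    ext ⟨g, x⟩
    simp only [Set.mem_preimage, Set.mem_univ_pi, Set.mem_prod,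
      Function.forall_update_iff g (fun j y => y ∈ s j),
      Function.forall_update_iff s (fun j t => g j ∈ t), Set.mem_univ, true_and, and_comm]
  rw [Measure.map_apply hmeas (MeasurableSet.univ_pi hs), hpreimage, Measure.prod_prod,
    Measure.pi_pi]
  simp only [Function.apply_update (fun j => (μ j : Set (α j) → ENNReal)), measure_univ,
    Finset.prod_update_of_mem (Finset.mem_univ i), one_mul, ← Finset.erase_eq,
    Finset.prod_erase_mul _ _ (Finset.mem_univ i)]

/-- Conjugation of the coefficients, with the variables self-adjoint: under evaluation at real
points it becomes complex conjugation. -/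
noncomputable instance instStarRingMvPolynomial {σ R : Type*} [CommSemiring R] [StarRing R] :
    StarRing (MvPolynomial σ R) where
  star p := p.map (starRingEnd R)
  star_involutive p := by
    ext m
    simp only [MvPolynomial.coeff_map, starRingEnd_self_apply]
  star_mul p q := by rw [map_mul, mul_comm]
  star_add := map_add _

theorem star_mvPolynomial_def {σ R : Type*} [CommSemiring R] [StarRing R] (p : MvPolynomial σ R) :
    star p = p.map (starRingEnd R) := rfl

instance instStarModuleMvPolynomial {σ R : Type*} [CommSemiring R] [StarRing R] :
    StarModule R (MvPolynomial σ R) where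
  star_smul c p := by
    simp [star_mvPolynomial_def, MvPolynomial.smul_eq_C_mul, starRingEnd_apply]

section RealEval

variable {ι : Type*}

/-- Evaluation of a complex polynomial at a real point. -/
noncomputable def realEval (g : ι → ℝ) : MvPolynomial ι ℂ →ₐ[ℂ] ℂ :=
  MvPolynomial.aeval fun i => (g i : ℂ)

@[simp] theorem realEval_X (g : ι → ℝ) (i : ι) : realEval g (MvPolynomial.X i) = g i := by
  simp [realEval]

@[simp] theorem realEval_C (g : ι → ℝ) (a : ℂ) : realEval g (MvPolynomial.C a) = a := by
  simp [realEval]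

theorem continuous_realEval (p : MvPolynomial ι ℂ) : Continuous fun g : ι → ℝ => realEval g p := by
  induction p using MvPolynomial.induction_on with
  | C a => simpa using continuous_const
  | add p q hp hq => simp only [map_add]; exact hp.add hq
  | mul_X p j hp =>
    simp only [map_mul, realEval_X]
    exact hp.mul (Complex.continuous_ofReal.comp (continuous_apply j))

theorem realEval_star (g : ι → ℝ) (p : MvPolynomial ι ℂ) :
    realEval g (star p) = star (realEval g p) := by
  rw [star_mvPolynomial_def]
  induction p using MvPolynomial.induction_on with
  | C a => simp
  | add p q hp hq => simp [hp, hq]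
  | mul_X p j hp => simp [hp]

theorem realEval_mul_star (g : ι → ℝ) (p : MvPolynomial ι ℂ) :
    realEval g (p * star p) = (‖realEval g p‖ ^ 2 : ℝ) := by
  rw [map_mul, realEval_star, Complex.star_def, Complex.mul_conj, Complex.normSq_eq_norm_sq]

theorem hasDerivAt_realEval_update [DecidableEq ι] (p : MvPolynomial ι ℂ)
    (g : ι → ℝ) (i : ι) (x : ℝ) :
    HasDerivAt (fun x : ℝ => realEval (Function.update g i x) p)
      (realEval (Function.update g i x) (MvPolynomial.pderiv i p)) x := by
  induction p using MvPolynomial.induction_on with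
  | C a => simpa using hasDerivAt_const x a
  | add p q hp hq => simp only [map_add]; exact hp.add hq
  | mul_X p j hp =>
    have hX : HasDerivAt (fun x : ℝ => ((Function.update g i x j : ℝ) : ℂ))
        (realEval (Function.update g i x)
          (Pi.single (M := fun _ => MvPolynomial ι ℂ) i 1 j)) x := by
      rcases eq_or_ne j i with rfl | h
      · simp only [Function.update_self, Pi.single_eq_same, map_one]
        exact Complex.ofRealCLM.hasDerivAt
      · simpa [Function.update_of_ne h, Pi.single_eq_of_ne h] using
          hasDerivAt_const x ((g j : ℝ) : ℂ)
    simp only [map_mul, realEval_X, Derivation.leibniz, smul_eq_mul, map_add,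
      MvPolynomial.pderiv_X]
    refine (hp.mul hX).congr_deriv ?_
    ring

/-- `q` is purely imaginary at all real points, so that `exp q` has modulus one. -/
def IsPhase (q : MvPolynomial ι ℂ) : Prop := ∀ g : ι → ℝ, (realEval g q).re = 0

theorem IsPhase.norm_exp {q : MvPolynomial ι ℂ} (hq : IsPhase q) (g : ι → ℝ) :
    ‖Complex.exp (realEval g q)‖ = 1 := by
  rw [Complex.norm_exp, hq g, Real.exp_zero]

theorem isPhase_zero : IsPhase (0 : MvPolynomial ι ℂ) := fun g => by simp

end RealEval

section PhaseIntegral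

variable {ι : Type*} [Fintype ι]

/-- The law of independent standard real Gaussian variables indexed by `ι`. -/
noncomputable abbrev stdGaussianPi (ι : Type*) [Fintype ι] : Measure (ι → ℝ) :=
  Measure.pi fun _ => gaussianReal 0 1

theorem integrable_realEval (p : MvPolynomial ι ℂ) :
    Integrable (fun g => realEval g p) (stdGaussianPi ι) := by
  induction p using MvPolynomial.monomial_add_induction_on with
  | C a => simp
  | monomial_add a b f _ _ hf =>
    have hmonomial (g : ι → ℝ) :
        realEval g (MvPolynomial.monomial a b) = b * ∏ i, (g i : ℂ) ^ a i := by
      simp [realEval, MvPolynomial.aeval_monomial, Finsupp.prod_fintype]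
    simp only [map_add, hmonomial]
    refine (Integrable.const_mul ?_ b).add hf
    refine Integrable.fintype_prod (f := fun i (x : ℝ) => (x : ℂ) ^ a i) fun i => ?_
    have hmoment : MemLp (id : ℝ → ℝ) (a i : ENNReal) (gaussianReal 0 1) :=
      memLp_id_gaussianReal' _ (by simp)
    exact (integrable_norm_iff (by fun_prop)).1 (by simpa using hmoment.integrable_norm_pow')

theorem IsPhase.integrable {q : MvPolynomial ι ℂ} (hq : IsPhase q) (p : MvPolynomial ι ℂ) :
    Integrable (fun g => realEval g p * Complex.exp (realEval g q)) (stdGaussianPi ι) :=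
  (integrable_realEval p).mul_bdd (c := 1)
    (Complex.continuous_exp.comp (continuous_realEval q)).aestronglyMeasurable
    (ae_of_all _ fun g => (hq.norm_exp g).le)

/-- The expectation of `p` against the phase `exp q` under the standard Gaussian measure. -/
noncomputable def phaseIntegral {q : MvPolynomial ι ℂ} (hq : IsPhase q) :
    MvPolynomial ι ℂ →ₗ[ℂ] ℂ where
  toFun p := ∫ g, realEval g p * Complex.exp (realEval g q) ∂stdGaussianPi ι
  map_add' p p' := by
    simp only [map_add, add_mul]
    exact integral_add (hq.integrable p) (hq.integrable p')
  map_smul' c p := by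
    simp only [map_smul, smul_eq_mul, mul_assoc, RingHom.id_apply]
    exact integral_const_mul _ _

theorem phaseIntegral_apply {q : MvPolynomial ι ℂ} (hq : IsPhase q) (p : MvPolynomial ι ℂ) :
    phaseIntegral hq p = ∫ g, realEval g p * Complex.exp (realEval g q) ∂stdGaussianPi ι := rfl

variable [DecidableEq ι]

theorem IsPhase.integrable_update {q : MvPolynomial ι ℂ} (hq : IsPhase q) (i : ι)
    (p : MvPolynomial ι ℂ) :
    Integrable (fun z : (ι → ℝ) × ℝ => realEval (Function.update z.1 i z.2) p *
      Complex.exp (realEval (Function.update z.1 i z.2) q))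
      ((stdGaussianPi ι).prod (gaussianReal 0 1)) :=
  ((measurePreserving_update (fun _ : ι => gaussianReal 0 1) i).integrable_comp
    (hq.integrable p).aestronglyMeasurable).2 (hq.integrable p)

theorem phaseIntegral_eq_integral_update {q : MvPolynomial ι ℂ} (hq : IsPhase q) (i : ι)
    (p : MvPolynomial ι ℂ) :
    phaseIntegral hq p = ∫ g, ∫ x, realEval (Function.update g i x) p *
      Complex.exp (realEval (Function.update g i x) q) ∂gaussianReal 0 1 ∂stdGaussianPi ι := by
  have hmp := measurePreserving_update (fun _ : ι => gaussianReal 0 1) i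
  rw [← integral_prod _ (hq.integrable_update i p), phaseIntegral_apply,
    ← integral_map (f := fun g => realEval g p * Complex.exp (realEval g q)) hmp.aemeasurable
      (by rw [hmp.map_eq]; exact (hq.integrable p).aestronglyMeasurable), hmp.map_eq]

omit [DecidableEq ι] in
theorem phaseIntegral_X_mul {q : MvPolynomial ι ℂ} (hq : IsPhase q) (i : ι)
    (p : MvPolynomial ι ℂ) :
    phaseIntegral hq (MvPolynomial.X i * p) =
      phaseIntegral hq (MvPolynomial.pderiv i p + p * MvPolynomial.pderiv i q) := by
  classical
  simp only [phaseIntegral_eq_integral_update hq i]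
  refine integral_congr_ae ?_
  filter_upwards [(hq.integrable_update i (MvPolynomial.X i * p)).prod_right_ae,
    (hq.integrable_update i p).prod_right_ae, (hq.integrable_update i
      (MvPolynomial.pderiv i p + p * MvPolynomial.pderiv i q)).prod_right_ae] with g hXp hp hdp
  have hderiv (x : ℝ) : HasDerivAt (fun x : ℝ => realEval (Function.update g i x) p *
      Complex.exp (realEval (Function.update g i x) q))
      (realEval (Function.update g i x) (MvPolynomial.pderiv i p + p * MvPolynomial.pderiv i q) *
        Complex.exp (realEval (Function.update g i x) q)) x := by
    refine ((hasDerivAt_realEval_update p g i x).mul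
      (hasDerivAt_realEval_update q g i x).cexp).congr_deriv ?_
    simp only [map_add, map_mul]
    ring
  have hX (x : ℝ) : realEval (Function.update g i x) (MvPolynomial.X i * p) *
      Complex.exp (realEval (Function.update g i x) q) =
        (x - 0) • (realEval (Function.update g i x) p *
          Complex.exp (realEval (Function.update g i x) q)) := by
    simp [mul_assoc]
  simp only [hX] at hXp ⊢
  simpa using integral_sub_smul_gaussianReal hderiv hp hdp hXp

end PhaseIntegral

/-! # Loop equations -/

open Finset in
/-- A family, indexed by letters `ε : κ`, of sequences of Gaussian random matrices, the entries of
size `n` being linear forms in independent standard real Gaussian variables indexed by `ι n`. The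
covariance of the entries `(i, j)` and `(k, l)` of the letters `ε` and `δ` is
`cov ε δ / n` if `i = l` and `j = k`, and zero otherwise; the adjoint of the letter `ε` is the
letter `adj ε`. -/
structure GaussianMatrixModel (κ : Type*) (ι : ℕ → Type*) [∀ n, Fintype (ι n)] where
  coeff {n : ℕ} : κ → Fin n → Fin n → ι n → ℂ
  adj : κ → κ
  cov : κ → κ → ℂ
  sum_coeff_mul_coeff {n : ℕ} (ε δ : κ) (i j k l : Fin n) :
    ∑ p, coeff ε i j p * coeff δ k l p = (n : ℂ)⁻¹ * cov ε δ * if i = l ∧ j = k then 1 else 0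
  star_coeff {n : ℕ} (ε : κ) (i j : Fin n) (p : ι n) :
    star (coeff ε i j p) = coeff (adj ε) j i p

/-- `n × n` matrices whose entries are polynomials in the variables indexed by `ι n`. -/
abbrev PolyMatrix (ι : ℕ → Type*) (n : ℕ) : Type _ := Matrix (Fin n) (Fin n) (MvPolynomial (ι n) ℂ)

/-- Sequences of matrices of growing size. -/
abbrev MatrixSeq (ι : ℕ → Type*) : Type _ := ∀ n, PolyMatrix ι n

theorem derivation_sum_apply {σ R A M : Type*} [CommSemiring R] [CommSemiring A]
    [AddCommMonoid M] [Algebra R A] [Module A M] [Module R M]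
    (s : Finset σ) (D : σ → Derivation R A M) (a : A) :
    (∑ i ∈ s, D i) a = ∑ i ∈ s, D i a := by
  simp only [← Derivation.coeFnAddMonoidHom_apply, map_sum, Finset.sum_apply]

namespace GaussianMatrixModel

open Finset

variable {κ : Type*} {ι : ℕ → Type*} [∀ n, Fintype (ι n)] (Γ : GaussianMatrixModel κ ι) {n : ℕ}

/-- The sequence of random matrices attached to the letter `ε`. -/
noncomputable def matrix (ε : κ) : MatrixSeq ι := fun _ =>
  Matrix.of fun i j => ∑ p, MvPolynomial.C (Γ.coeff ε i j p) * MvPolynomial.X p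

/-- The derivation which Gaussian integration by parts attaches to the entry `(i, j)` of the
letter `ε`. -/
noncomputable def deriv (ε : κ) (i j : Fin n) :
    Derivation ℂ (MvPolynomial (ι n) ℂ) (MvPolynomial (ι n) ℂ) :=
  ∑ p, Γ.coeff ε i j p • MvPolynomial.pderiv p

theorem deriv_apply (ε : κ) (i j : Fin n) (p : MvPolynomial (ι n) ℂ) :
    Γ.deriv ε i j p = ∑ a, Γ.coeff ε i j a • MvPolynomial.pderiv a p := by
  simp only [deriv, derivation_sum_apply, Derivation.smul_apply]

theorem phaseIntegral_matrix_mul {q : MvPolynomial (ι n) ℂ} (hq : IsPhase q) (ε : κ)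
    (i j : Fin n) (p : MvPolynomial (ι n) ℂ) :
    phaseIntegral hq (Γ.matrix ε n i j * p) =
      phaseIntegral hq (Γ.deriv ε i j p + p * Γ.deriv ε i j q) := by
  simp only [deriv_apply, matrix, Matrix.of_apply, sum_mul, mul_sum, map_sum,
    ← sum_add_distrib, MvPolynomial.C_mul', smul_mul_assoc, mul_smul_comm, ← smul_add,
    map_smul, phaseIntegral_X_mul]

theorem pderiv_matrix_apply (δ : κ) (k l : Fin n) (a : ι n) :
    MvPolynomial.pderiv a (Γ.matrix δ n k l) = MvPolynomial.C (Γ.coeff δ k l a) := by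
  classical
  simp [matrix, MvPolynomial.pderiv_X, Pi.single_apply,
    MvPolynomial.C_eq_smul_one]

theorem deriv_matrix_apply (ε δ : κ) (i j k l : Fin n) :
    Γ.deriv ε i j (Γ.matrix δ n k l) =
      ((n : ℂ)⁻¹ * Γ.cov ε δ) • if i = l ∧ j = k then 1 else 0 := by
  simp only [deriv_apply, pderiv_matrix_apply, MvPolynomial.smul_eq_C_mul, ← map_mul, ← map_sum,
    sum_coeff_mul_coeff]
  split_ifs <;> simp

theorem conjTranspose_matrix (ε : κ) : (Γ.matrix ε n).conjTranspose = Γ.matrix (Γ.adj ε) n := by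
  ext1 i j
  simp [matrix, star_mvPolynomial_def, starRingEnd_apply, Γ.star_coeff]

/-- The divergence `∑ D_{ij} Z_{ji}` in the direction of the letter `ε`. -/
noncomputable def div (ε : κ) (Z : PolyMatrix ι n) : MvPolynomial (ι n) ℂ :=
  ∑ i, ∑ j, Γ.deriv ε i j (Z j i)

/-- The derivation `∑ Z_{ji} D_{ij}` along `Z` in the direction of the letter `ε`. -/
noncomputable def grad (ε : κ) (Z : PolyMatrix ι n) :
    Derivation ℂ (MvPolynomial (ι n) ℂ) (MvPolynomial (ι n) ℂ) :=
  ∑ i, ∑ j, Z j i • Γ.deriv ε i j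

theorem grad_apply (ε : κ) (Z : PolyMatrix ι n) (p : MvPolynomial (ι n) ℂ) :
    Γ.grad ε Z p = ∑ i, ∑ j, Z j i * Γ.deriv ε i j p := by
  simp only [grad, derivation_sum_apply, Derivation.smul_apply, smul_eq_mul]

theorem phaseIntegral_trace_matrix_mul {q : MvPolynomial (ι n) ℂ} (hq : IsPhase q) (ε : κ)
    (Z : PolyMatrix ι n) (G : MvPolynomial (ι n) ℂ) :
    phaseIntegral hq ((Γ.matrix ε n * Z).trace * G) =
      phaseIntegral hq (Γ.div ε Z * G + Γ.grad ε Z G + G * Γ.grad ε Z q) := by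
  simp only [Matrix.trace, Matrix.diag_apply, Matrix.mul_apply, sum_mul, div, grad_apply,
    mul_sum, ← sum_add_distrib, map_sum, mul_assoc, phaseIntegral_matrix_mul]
  refine sum_congr rfl fun i _ => sum_congr rfl fun j _ => ?_
  rw [Derivation.leibniz, smul_eq_mul, smul_eq_mul]
  congr 1
  ring

theorem deriv_mul_apply (ε : κ) (i j k l : Fin n) (A B : PolyMatrix ι n) :
    Γ.deriv ε i j ((A * B) k l) =
      ∑ s, (Γ.deriv ε i j (A k s) * B s l + A k s * Γ.deriv ε i j (B s l)) := by
  simp only [Matrix.mul_apply, map_sum, Derivation.leibniz, smul_eq_mul]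
  exact sum_congr rfl fun s _ => by ring

/-- The free difference quotient of the sequence `A` with respect to the letter `ε` is
`∑ r ∈ s, c r • L r ⊗ R r`. -/
def IsSplit {σ : Type*} (ε : κ) (A : MatrixSeq ι) (s : Finset σ) (c : σ → ℂ)
    (L R : σ → MatrixSeq ι) : Prop :=
  ∀ (n : ℕ) (i j k l : Fin n),
    Γ.deriv ε i j (A n k l) = (n : ℂ)⁻¹ • ∑ r ∈ s, c r • (L r n k j * R r n i l)

namespace IsSplit

variable {Γ} {σ τ : Type*} {ε : κ} {A B : MatrixSeq ι} {s : Finset σ} {u : Finset τ}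
  {c : σ → ℂ} {d : τ → ℂ} {L R : σ → MatrixSeq ι} {L' R' : τ → MatrixSeq ι}

theorem div_eq (h : Γ.IsSplit ε A s c L R) (n : ℕ) :
    Γ.div ε (A n) = (n : ℂ)⁻¹ • ∑ r ∈ s, c r • ((L r n).trace * (R r n).trace) := by
  simp only [div, h _ _ _ _ _, ← smul_sum, Matrix.trace, Matrix.diag_apply]
  congr 1
  simp_rw [sum_comm (s := univ) (t := s)]
  refine sum_congr rfl fun r _ => ?_
  simp only [← smul_sum, sum_mul_sum]
  rw [sum_comm]

theorem grad_trace (h : Γ.IsSplit ε A s c L R) (n : ℕ) (Z : PolyMatrix ι n) :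
    Γ.grad ε Z (A n).trace = (n : ℂ)⁻¹ • ∑ r ∈ s, c r • (Z * (R r n * L r n)).trace := by
  simp only [grad_apply, Matrix.trace, Matrix.diag_apply, map_sum, h _ _ _ _ _, ← smul_sum,
    mul_smul_comm]
  congr 1
  simp only [Matrix.mul_apply, mul_sum, smul_sum, mul_smul_comm]
  simp_rw [sum_comm (s := univ) (t := s)]
  refine sum_congr rfl fun r _ => ?_
  rw [sum_comm]
  refine (sum_congr rfl fun i _ => sum_comm).trans (sum_comm.trans ?_)
  refine sum_congr rfl fun i _ => sum_congr rfl fun j _ => sum_congr rfl fun k _ => ?_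
  rw [mul_comm (R r n j k)]

theorem mul (hA : Γ.IsSplit ε A s c L R) (hB : Γ.IsSplit ε B u d L' R') :
    Γ.IsSplit ε (A * B) (s.disjSum u) (Sum.elim c d) (Sum.elim L fun r => A * L' r)
      (Sum.elim (fun r => R r * B) R') := by
  intro n i j k l
  rw [Pi.mul_apply, deriv_mul_apply]
  simp only [Pi.mul_apply, sum_add_distrib, sum_disjSum, Sum.elim_inl,
    Sum.elim_inr, smul_add, hA _ _ _ _ _, hB _ _ _ _ _, smul_mul_assoc, mul_smul_comm, ← smul_sum,
    Matrix.mul_apply, mul_sum, sum_mul, ← mul_assoc]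
  congr 2 <;> rw [sum_comm] <;> simp only [← smul_sum]

end IsSplit

theorem isSplit_one {σ : Type*} (ε : κ) (c : σ → ℂ) (L R : σ → MatrixSeq ι) :
    Γ.IsSplit ε 1 ∅ c L R := by
  intro n i j k l
  rw [Pi.one_apply, Matrix.one_apply]
  split_ifs <;> simp

theorem isSplit_matrix (ε δ : κ) :
    Γ.IsSplit ε (Γ.matrix δ) (univ : Finset Unit) (fun _ => Γ.cov ε δ) 1 1 := by
  intro n i j k l
  simp [deriv_matrix_apply, Matrix.one_apply, ite_and, mul_smul, eq_comm (a := j)]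

variable {Γ} in
theorem IsSplit.deriv_matrix_mul {σ : Type*} {ε : κ} {A : MatrixSeq ι} {s : Finset σ}
    {c : σ → ℂ} {L R : σ → MatrixSeq ι} (h : Γ.IsSplit ε A s c L R) (δ : κ) (n : ℕ)
    (i j k l : Fin n) :
    Γ.deriv ε i j ((Γ.matrix δ * A) n k l) = (n : ℂ)⁻¹ •
      (Γ.cov ε δ • ((1 : PolyMatrix ι n) k j * A n i l) +
        ∑ r ∈ s, c r • ((Γ.matrix δ n * L r n) k j * R r n i l)) := by
  simpa [smul_add] using (Γ.isSplit_matrix ε δ).mul h n i j k l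

/-- The product of the letters of a word. -/
noncomputable def word (w : List κ) : MatrixSeq ι := (w.map Γ.matrix).prod

@[simp] theorem word_nil : Γ.word [] = 1 := rfl

theorem word_cons (ε : κ) (w : List κ) : Γ.word (ε :: w) = Γ.matrix ε * Γ.word w := by
  simp [word]

theorem word_append (v w : List κ) : Γ.word (v ++ w) = Γ.word v * Γ.word w := by
  simp [word]

theorem word_replicate (m : ℕ) (ε : κ) : Γ.word (List.replicate m ε) = Γ.matrix ε ^ m := by
  simp [word]

theorem isSplit_word (ε : κ) (w : List κ) :
    Γ.IsSplit ε (Γ.word w) univ (fun r : Fin w.length => Γ.cov ε w[r])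
      (fun r => Γ.word (w.take r)) (fun r => Γ.word (w.drop (r + 1))) := by
  induction w with
  | nil => simpa using Γ.isSplit_one ε _ _ _
  | cons δ w ih =>
    intro n i j k l
    rw [word_cons, ih.deriv_matrix_mul]
    simp [Fin.sum_univ_succ, word_cons]

/-- The Chebyshev polynomial of the second kind of degree `j` in the letter `δ`, rescaled by the
variance of this letter. -/
noncomputable def chebyshevU (δ : κ) (j : ℕ) : MatrixSeq ι :=
  Polynomial.aeval (Γ.matrix δ) (Polynomial.dickson 2 (Γ.cov δ δ) j)

@[simp] theorem chebyshevU_zero (δ : κ) : Γ.chebyshevU δ 0 = 1 := by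
  rw [chebyshevU, Polynomial.dickson_zero]
  norm_num

@[simp] theorem chebyshevU_one (δ : κ) : Γ.chebyshevU δ 1 = Γ.matrix δ := by
  simp [chebyshevU]

theorem chebyshevU_add_two (δ : κ) (j : ℕ) :
    Γ.chebyshevU δ (j + 2) =
      Γ.matrix δ * Γ.chebyshevU δ (j + 1) - Γ.cov δ δ • Γ.chebyshevU δ j := by
  simp [chebyshevU, Polynomial.dickson_add_two, ← Algebra.smul_def]

theorem isSplit_chebyshevU (ε δ : κ) (j : ℕ) :
    Γ.IsSplit ε (Γ.chebyshevU δ j) (range j) (fun _ => Γ.cov ε δ)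
      (Γ.chebyshevU δ) (fun r => Γ.chebyshevU δ (j - 1 - r)) := by
  induction j using Nat.twoStepInduction with
  | zero => simpa using Γ.isSplit_one ε _ _ _
  | one => simpa [IsSplit] using Γ.isSplit_matrix ε δ
  | more d h0 h1 =>
    intro n i j k l
    have hcomm (x : MvPolynomial (ι n) ℂ) :
        Γ.cov δ δ • (n : ℂ)⁻¹ • x = (n : ℂ)⁻¹ • Γ.cov δ δ • x := smul_comm _ _ _
    rw [chebyshevU_add_two, Pi.sub_apply, Pi.smul_apply, Matrix.sub_apply, map_sub,
      Matrix.smul_apply, Derivation.map_smul, h1.deriv_matrix_mul, h0, hcomm, ← smul_sub,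
      sum_range_succ' _ (d + 1), sum_range_succ' _ d, sum_range_succ' _ d]
    congr 1
    have hterm (r : ℕ) : Γ.cov ε δ • (Γ.chebyshevU δ (r + 2) n k j *
        Γ.chebyshevU δ (d + 2 - 1 - (r + 1 + 1)) n i l) =
        Γ.cov ε δ • ((Γ.matrix δ n * Γ.chebyshevU δ (r + 1) n) k j *
          Γ.chebyshevU δ (d + 1 - 1 - (r + 1)) n i l) -
        Γ.cov δ δ • Γ.cov ε δ • (Γ.chebyshevU δ r n k j * Γ.chebyshevU δ (d - 1 - r) n i l) := by
      rw [show d + 2 - 1 - (r + 1 + 1) = d - 1 - r by omega,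
        show d + 1 - 1 - (r + 1) = d - 1 - r by omega, smul_comm, ← smul_sub, chebyshevU_add_two]
      simp [sub_mul]
    simp only [sum_congr rfl fun r _ => hterm r, sum_sub_distrib, ← smul_sum]
    simp only [add_tsub_cancel_right, chebyshevU_zero, Pi.one_apply, mul_one, tsub_zero, zero_add,
      chebyshevU_one, Nat.add_one_sub_one]
    abel

theorem grad_trace_aeval (ε δ : κ) (p : Polynomial ℂ) (Z : PolyMatrix ι n) :
    Γ.grad ε Z (Polynomial.aeval (Γ.matrix δ) p n).trace =
      ((n : ℂ)⁻¹ * Γ.cov ε δ) •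
        (Z * Polynomial.aeval (Γ.matrix δ) (Polynomial.derivative p) n).trace := by
  induction p using Polynomial.induction_on' with
  | add p q hp hq =>
    simp only [map_add, Pi.add_apply, Matrix.trace_add, hp, hq, mul_add, smul_add]
  | monomial k a =>
    have hpow : Γ.grad ε Z (Γ.matrix δ n ^ k).trace =
        ((n : ℂ)⁻¹ * Γ.cov ε δ) • k • (Z * Γ.matrix δ n ^ (k - 1)).trace := by
      have hterm (r : Fin (List.replicate k δ).length) :
          k - (r + 1 : ℕ) + min (r : ℕ) k = k - 1 := by
        have := r.isLt.trans_eq List.length_replicate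
        omega
      have hsplit := (Γ.isSplit_word ε (List.replicate k δ)).grad_trace n Z
      simpa [word_replicate, List.drop_replicate, List.take_replicate, ← pow_add, hterm, mul_smul,
        smul_comm (Γ.cov ε δ) k] using hsplit
    simp only [Polynomial.aeval_monomial, Polynomial.derivative_monomial, ← Algebra.smul_def,
      Pi.smul_apply, Pi.pow_apply, Matrix.trace_smul, Derivation.map_smul, hpow, mul_smul_comm,
      mul_smul, ← Nat.cast_smul_eq_nsmul ℂ]
    simp only [smul_smul]
    congr 1
    ring

end GaussianMatrixModel

section Dickson

variable {R : Type*} [CommRing R] (a : R) (k : ℕ)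

open Polynomial in
theorem dickson_one_add_two_eq :
    dickson 1 a (k + 2) = X * dickson 2 a (k + 1) - C (2 * a) * dickson 2 a k := by
  induction k using Nat.twoStepInduction with
  | zero =>
    simp only [dickson_add_two, dickson_zero, dickson_one, zero_add, map_mul, map_ofNat]
    push_cast
    ring
  | one =>
    simp only [dickson_add_two, dickson_zero, dickson_one, zero_add, map_mul, map_ofNat]
    push_cast
    ring
  | more k h0 h1 =>
    rw [dickson_add_two _ _ (k + 2), h0, h1, dickson_add_two 2 _ (k + 1), dickson_add_two 2 _ k]
    simp only [map_mul, map_ofNat]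
    ring

open Polynomial in
theorem derivative_dickson_one :
    derivative (dickson 1 a (k + 1)) = (k + 1 : ℕ) * dickson 2 a k := by
  induction k using Nat.twoStepInduction with
  | zero =>
    simp only [dickson_zero, dickson_one, zero_add, derivative_X]
    push_cast
    ring
  | one =>
    simp only [dickson_add_two, dickson_zero, dickson_one, zero_add, derivative_sub,
      derivative_mul, derivative_X, derivative_C]
    norm_num
    ring
  | more k h0 h1 =>
    rw [dickson_add_two, derivative_sub, derivative_mul, derivative_C_mul, h0, h1, derivative_X,
      dickson_one_add_two_eq, dickson_add_two 2 _ k]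
    simp only [map_mul, map_ofNat]
    push_cast
    ring

end Dickson

/-! # Bounds on the moments of centred traces -/

section GaussianMean

variable {ι : Type*} [Fintype ι]

/-- The expectation of a polynomial in independent standard Gaussian variables. -/
noncomputable def gaussianMean : MvPolynomial ι ℂ →ₗ[ℂ] ℂ := phaseIntegral isPhase_zero

theorem gaussianMean_apply (p : MvPolynomial ι ℂ) :
    gaussianMean p = ∫ g, realEval g p ∂stdGaussianPi ι := by
  simp [gaussianMean, phaseIntegral_apply]

@[simp] theorem gaussianMean_C (a : ℂ) :
    gaussianMean (MvPolynomial.C a : MvPolynomial ι ℂ) = a := by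
  simp [gaussianMean_apply]

@[simp] theorem gaussianMean_one : gaussianMean (1 : MvPolynomial ι ℂ) = 1 := gaussianMean_C 1

/-- The fluctuation of a polynomial in Gaussian variables around its expectation. -/
noncomputable def fluct : MvPolynomial ι ℂ →ₗ[ℂ] MvPolynomial ι ℂ :=
  LinearMap.id - (Algebra.linearMap ℂ (MvPolynomial ι ℂ)).comp gaussianMean

theorem fluct_apply (p : MvPolynomial ι ℂ) : fluct p = p - MvPolynomial.C (gaussianMean p) := rfl

@[simp] theorem fluct_C (a : ℂ) : fluct (MvPolynomial.C a : MvPolynomial ι ℂ) = 0 := by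
  simp [fluct_apply]

theorem gaussianMean_fluct_mul (p q : MvPolynomial ι ℂ) :
    gaussianMean (fluct p * q) = gaussianMean (p * q) - gaussianMean p * gaussianMean q := by
  rw [fluct_apply, sub_mul, map_sub, MvPolynomial.C_mul', map_smul, smul_eq_mul]

theorem gaussianMean_mul (p q : MvPolynomial ι ℂ) :
    gaussianMean (p * q) =
      gaussianMean p * gaussianMean q + gaussianMean (fluct p * fluct q) := by
  rw [gaussianMean_fluct_mul, mul_comm p (fluct q), gaussianMean_fluct_mul, fluct_apply q,
    map_sub, gaussianMean_C, mul_comm q p]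
  ring

theorem fluct_mul (p q : MvPolynomial ι ℂ) :
    fluct (p * q) =
      fluct (fluct p * fluct q) + gaussianMean p • fluct q + gaussianMean q • fluct p := by
  rw [fluct_apply (p * q), gaussianMean_mul p q, fluct_apply (fluct p * fluct q)]
  generalize gaussianMean (fluct p * fluct q) = z
  simp only [fluct_apply, map_add, map_mul, MvPolynomial.smul_eq_C_mul]
  ring

end GaussianMean

open Asymptotics in
/-- The algebra of bounded complex sequences. -/
def boundedSeq : Subalgebra ℂ (ℕ → ℂ) where
  carrier := {a | a =O[atTop] fun _ => (1 : ℝ)}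
  mul_mem' ha hb := by simpa using IsBigO.mul ha hb
  add_mem' := IsBigO.add
  algebraMap_mem' c := isBigO_const_const c one_ne_zero _

theorem mem_boundedSeq_of_tendsto {a : ℕ → ℂ} {z : ℂ} (h : Tendsto a atTop (nhds z)) :
    a ∈ boundedSeq := h.isBigO_one ℝ

/-- The sequence `1 / n`. -/
noncomputable def invSeq : ℕ → ℂ := fun n => (n : ℂ)⁻¹

theorem tendsto_invSeq : Tendsto invSeq atTop (nhds 0) := tendsto_inv_atTop_nhds_zero_nat

theorem invSeq_mem_boundedSeq : invSeq ∈ boundedSeq := mem_boundedSeq_of_tendsto tendsto_invSeq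

/-- Sequences of polynomials in the variables indexed by `ι n`. -/
abbrev PolySeq (ι : ℕ → Type*) : Type _ := ∀ n, MvPolynomial (ι n) ℂ

section Traces

variable {ι : ℕ → Type*} [∀ n, Fintype (ι n)]

/-- The sequence of the expectations of a sequence of polynomials in Gaussian variables. -/
noncomputable def meanSeq : PolySeq ι →ₗ[ℂ] ℕ → ℂ :=
  LinearMap.pi fun n => gaussianMean ∘ₗ LinearMap.proj n

/-- The sequence of the normalised expected traces of a sequence of matrices. -/
noncomputable def meanTrace : MatrixSeq ι →ₗ[ℂ] ℕ → ℂ :=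
  LinearMap.pi fun n =>
    (n : ℂ)⁻¹ • gaussianMean ∘ₗ Matrix.traceLinearMap (Fin n) ℂ _ ∘ₗ LinearMap.proj n

/-- The sequence of the centred traces of a sequence of matrices. -/
noncomputable def fluctTrace : MatrixSeq ι →ₗ[ℂ] PolySeq ι :=
  LinearMap.pi fun n => fluct ∘ₗ Matrix.traceLinearMap (Fin n) ℂ _ ∘ₗ LinearMap.proj n

theorem meanSeq_apply (p : PolySeq ι) (n : ℕ) : meanSeq p n = gaussianMean (p n) := rfl

@[simp] theorem meanSeq_one : meanSeq (1 : PolySeq ι) = 1 := funext fun _ => gaussianMean_one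

theorem meanTrace_apply (A : MatrixSeq ι) (n : ℕ) :
    meanTrace A n = (n : ℂ)⁻¹ * gaussianMean (A n).trace := rfl

theorem fluctTrace_apply (A : MatrixSeq ι) (n : ℕ) : fluctTrace A n = fluct (A n).trace := rfl

theorem meanTrace_one {n : ℕ} (hn : n ≠ 0) : meanTrace (1 : MatrixSeq ι) n = 1 := by
  simp only [meanTrace_apply, Pi.one_apply, Matrix.trace_one, Fintype.card_fin]
  rw [← map_natCast (MvPolynomial.C : ℂ →+* _), gaussianMean_C,
    inv_mul_cancel₀ (Nat.cast_ne_zero.2 hn)]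

theorem tendsto_meanTrace_one : Tendsto (meanTrace (1 : MatrixSeq ι)) atTop (nhds 1) :=
  tendsto_const_nhds.congr' ((eventually_ne_atTop 0).mono fun _ hn => (meanTrace_one hn).symm)

@[simp] theorem fluctTrace_one : fluctTrace (1 : MatrixSeq ι) = 0 := by
  funext n
  simp only [fluctTrace_apply, Pi.one_apply, Matrix.trace_one, Fintype.card_fin]
  rw [← map_natCast (MvPolynomial.C : ℂ →+* _), fluct_C, Pi.zero_apply]

end Traces

namespace GaussianMatrixModel

open Finset

variable {κ : Type*} {ι : ℕ → Type*} [∀ n, Fintype (ι n)] (Γ : GaussianMatrixModel κ ι) {n : ℕ}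

theorem gaussianMean_trace_matrix_mul (ε : κ) (Z : PolyMatrix ι n) :
    gaussianMean (Γ.matrix ε n * Z).trace = gaussianMean (Γ.div ε Z) := by
  simpa [gaussianMean] using Γ.phaseIntegral_trace_matrix_mul isPhase_zero ε Z 1

theorem phaseIntegral_fluct_trace_matrix_mul {q : MvPolynomial (ι n) ℂ} (hq : IsPhase q) (ε : κ)
    (Z : PolyMatrix ι n) (G : MvPolynomial (ι n) ℂ) :
    phaseIntegral hq (fluct (Γ.matrix ε n * Z).trace * G) =
      phaseIntegral hq (fluct (Γ.div ε Z) * G + Γ.grad ε Z G + G * Γ.grad ε Z q) := by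
  rw [fluct_apply, fluct_apply, gaussianMean_trace_matrix_mul, sub_mul, map_sub,
    phaseIntegral_trace_matrix_mul, ← map_sub]
  congr 1
  ring

theorem grad_fluct (ε : κ) (Z : PolyMatrix ι n) (p : MvPolynomial (ι n) ℂ) :
    Γ.grad ε Z (fluct p) = Γ.grad ε Z p := by
  rw [fluct_apply, map_sub, MvPolynomial.derivation_C, sub_zero]

namespace IsSplit

variable {Γ} {σ : Type*} {ε : κ} {A : MatrixSeq ι} {s : Finset σ} {c : σ → ℂ}
  {L R : σ → MatrixSeq ι}

theorem fluct_div (h : Γ.IsSplit ε A s c L R) (n : ℕ) :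
    fluct (Γ.div ε (A n)) = ∑ r ∈ s, c r •
      ((n : ℂ)⁻¹ • fluct (fluctTrace (L r) n * fluctTrace (R r) n) +
        meanTrace (L r) n • fluctTrace (R r) n + meanTrace (R r) n • fluctTrace (L r) n) := by
  simp only [h.div_eq, map_smul, map_sum, fluct_mul (L _ n).trace, meanTrace_apply, mul_smul,
    fluctTrace_apply, smul_sum, smul_add, smul_comm (n : ℂ)⁻¹ (c _)]

theorem meanTrace_matrix_mul (h : Γ.IsSplit ε A s c L R) :
    meanTrace (Γ.matrix ε * A) = ∑ r ∈ s, c r • (meanTrace (L r) * meanTrace (R r) +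
      invSeq * invSeq * meanSeq (fluctTrace (L r) * fluctTrace (R r))) := by
  funext n
  simp only [meanTrace_apply, Pi.mul_apply, gaussianMean_trace_matrix_mul, h.div_eq, map_smul,
    map_sum, gaussianMean_mul (L _ n).trace, Finset.sum_apply, Pi.smul_apply, Pi.add_apply,
    meanSeq_apply, fluctTrace_apply, smul_eq_mul, mul_sum, invSeq]
  exact sum_congr rfl fun r _ => by ring

theorem meanSeq_fluctTrace_matrix_mul (h : Γ.IsSplit ε A s c L R) (G : PolySeq ι) :
    meanSeq (fluctTrace (Γ.matrix ε * A) * G) = ∑ r ∈ s, c r •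
      (invSeq * (meanSeq (fluctTrace (L r) * (fluctTrace (R r) * G)) -
          meanSeq (fluctTrace (L r) * fluctTrace (R r)) * meanSeq G) +
        meanTrace (L r) * meanSeq (fluctTrace (R r) * G) +
        meanTrace (R r) * meanSeq (fluctTrace (L r) * G)) +
      meanSeq fun n => Γ.grad ε (A n) (G n) := by
  funext n
  have hloop := Γ.phaseIntegral_fluct_trace_matrix_mul isPhase_zero ε (A n) (G n)
  rw [map_zero, mul_zero, add_zero, h.fluct_div] at hloop
  simp only [meanSeq_apply, Pi.mul_apply, Pi.add_apply, fluctTrace_apply (Γ.matrix ε * A)]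
  refine hloop.trans ?_
  change gaussianMean _ = _
  simp only [map_add, sum_mul, map_sum, Finset.sum_apply, Pi.smul_apply, Pi.add_apply,
    Pi.mul_apply, Pi.sub_apply, meanSeq_apply, smul_mul_assoc, add_mul, map_smul,
    gaussianMean_fluct_mul (fluctTrace (L _) n * fluctTrace (R _) n), smul_eq_mul, mul_assoc,
    invSeq]

end IsSplit

/-- The product of the centred traces of a list of words. -/
noncomputable def fluctProd (ws : List (List κ)) : PolySeq ι :=
  (ws.map fun w => fluctTrace (Γ.word w)).prod

@[simp] theorem fluctProd_nil : Γ.fluctProd [] = 1 := rfl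

@[simp] theorem fluctProd_cons (w : List κ) (ws : List (List κ)) :
    Γ.fluctProd (w :: ws) = fluctTrace (Γ.word w) * Γ.fluctProd ws := by
  simp [fluctProd]

theorem fluctProd_append (us ws : List (List κ)) :
    Γ.fluctProd (us ++ ws) = Γ.fluctProd us * Γ.fluctProd ws := by
  simp [fluctProd]

/-- The moments of total length less than `N` of the centred traces of words are bounded, together
with the normalised expected traces of the words of length less than `N`. -/
structure MomentsBounded (N : ℕ) : Prop where
  meanTrace_mem {w : List κ} : w.length < N → meanTrace (Γ.word w) ∈ boundedSeq
  meanSeq_mem {ws : List (List κ)} :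
    (ws.map List.length).sum < N → meanSeq (Γ.fluctProd ws) ∈ boundedSeq

theorem meanSeq_grad_fluctTrace_word (ε : κ) (v w : List κ) (G : PolySeq ι) :
    meanSeq (fun n => Γ.grad ε (Γ.word v n) (fluctTrace (Γ.word w) n) * G n) =
      ∑ r : Fin w.length, Γ.cov ε w[r] •
        (invSeq * meanSeq (fluctTrace (Γ.word (v ++ (w.drop (r + 1) ++ w.take r))) * G) +
          meanTrace (Γ.word (v ++ (w.drop (r + 1) ++ w.take r))) * meanSeq G) := by
  funext n
  simp only [meanSeq_apply, fluctTrace_apply, grad_fluct, (Γ.isSplit_word ε w).grad_trace,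
    word_append, Finset.sum_apply, Pi.smul_apply, Pi.add_apply, Pi.mul_apply, smul_mul_assoc,
    sum_mul, map_smul, map_sum, smul_eq_mul, mul_sum, gaussianMean_fluct_mul, meanTrace_apply,
    invSeq]
  exact sum_congr rfl fun r _ => by ring

namespace MomentsBounded

variable {Γ} {N : ℕ} (h : Γ.MomentsBounded N)
include h

theorem meanSeq_grad_fluctTrace_mem (ε : κ) (v w : List κ) {ws : List (List κ)}
    (hN : v.length + w.length + (ws.map List.length).sum < N) :
    meanSeq (fun n => Γ.grad ε (Γ.word v n) (fluctTrace (Γ.word w) n) * Γ.fluctProd ws n) ∈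
      boundedSeq := by
  rw [meanSeq_grad_fluctTrace_word]
  refine sum_mem fun r _ => boundedSeq.smul_mem (add_mem ?_ ?_) _
  · rw [← fluctProd_cons]
    refine mul_mem invSeq_mem_boundedSeq (h.meanSeq_mem ?_)
    grind
  · exact mul_mem (h.meanTrace_mem (by grind)) (h.meanSeq_mem (by omega))

theorem meanSeq_grad_fluctProd_mem (ε : κ) (v : List κ) (us : List (List κ))
    {ws : List (List κ)}
    (hN : v.length + (us.map List.length).sum + (ws.map List.length).sum < N) :
    meanSeq (fun n => Γ.grad ε (Γ.word v n) (Γ.fluctProd us n) * Γ.fluctProd ws n) ∈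
      boundedSeq := by
  induction us generalizing ws with
  | nil => simp [← Pi.zero_def]
  | cons u us ih =>
    simp only [List.map_cons, List.sum_cons] at hN
    have hleibniz : (fun n => Γ.grad ε (Γ.word v n) (Γ.fluctProd (u :: us) n) *
        Γ.fluctProd ws n) =
        (fun n => Γ.grad ε (Γ.word v n) (Γ.fluctProd us n) * Γ.fluctProd (u :: ws) n) +
        fun n => Γ.grad ε (Γ.word v n) (fluctTrace (Γ.word u) n) * Γ.fluctProd (us ++ ws) n := by
      funext n
      simp only [fluctProd_cons, fluctProd_append, Pi.mul_apply, Pi.add_apply,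
        Derivation.leibniz, smul_eq_mul]
      ring
    rw [hleibniz, map_add]
    refine add_mem (ih ?_) (h.meanSeq_grad_fluctTrace_mem ε v u ?_)
    · simp only [List.map_cons, List.sum_cons]
      omega
    · simp only [List.map_append, List.sum_append]
      omega

theorem meanSeq_fluctTrace_mul_fluctTrace_mem {v w : List κ} (hN : v.length + w.length < N) :
    meanSeq (fluctTrace (Γ.word v) * fluctTrace (Γ.word w)) ∈ boundedSeq := by
  simpa using h.meanSeq_mem (ws := [v, w]) (by simpa using hN)

theorem meanTrace_word_cons_mem (ε : κ) {w : List κ} (hw : w.length < N) :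
    meanTrace (Γ.word (ε :: w)) ∈ boundedSeq := by
  rw [word_cons, (Γ.isSplit_word ε w).meanTrace_matrix_mul]
  refine sum_mem fun r _ => boundedSeq.smul_mem (add_mem (mul_mem ?_ ?_)
    (mul_mem (mul_mem invSeq_mem_boundedSeq invSeq_mem_boundedSeq) ?_)) _
  · exact h.meanTrace_mem (by grind)
  · exact h.meanTrace_mem (by grind)
  · exact h.meanSeq_fluctTrace_mul_fluctTrace_mem (by grind)

theorem meanSeq_fluctProd_cons_cons_mem (ε : κ) {w : List κ} {ws : List (List κ)}
    (hN : w.length + (ws.map List.length).sum < N) :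
    meanSeq (Γ.fluctProd ((ε :: w) :: ws)) ∈ boundedSeq := by
  rw [fluctProd_cons, word_cons, (Γ.isSplit_word ε w).meanSeq_fluctTrace_matrix_mul]
  refine add_mem (sum_mem fun r _ => boundedSeq.smul_mem (add_mem (add_mem
    (mul_mem invSeq_mem_boundedSeq (sub_mem ?_ (mul_mem ?_ ?_))) (mul_mem ?_ ?_))
    (mul_mem ?_ ?_)) _) ?_
  · rw [← fluctProd_cons, ← fluctProd_cons]
    exact h.meanSeq_mem (by grind)
  · exact h.meanSeq_fluctTrace_mul_fluctTrace_mem (by grind)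
  · exact h.meanSeq_mem (by omega)
  · exact h.meanTrace_mem (by grind)
  · rw [← fluctProd_cons]
    exact h.meanSeq_mem (by grind)
  · exact h.meanTrace_mem (by grind)
  · rw [← fluctProd_cons]
    exact h.meanSeq_mem (by grind)
  · simpa using h.meanSeq_grad_fluctProd_mem ε w ws (ws := []) (by simpa using hN)

end MomentsBounded

theorem momentsBounded (N : ℕ) : Γ.MomentsBounded N := by
  induction N with
  | zero => exact ⟨fun h => absurd h (Nat.not_lt_zero _), fun h => absurd h (Nat.not_lt_zero _)⟩
  | succ N ih =>
    refine ⟨fun {w} hw => ?_, fun {ws} hws => ?_⟩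
    · cases w with
      | nil => simpa using mem_boundedSeq_of_tendsto tendsto_meanTrace_one
      | cons ε w => exact ih.meanTrace_word_cons_mem ε (by simpa using hw)
    · match ws with
      | [] => simp
      | [] :: ws => simp
      | (ε :: w) :: ws => exact ih.meanSeq_fluctProd_cons_cons_mem ε (by grind)

theorem meanSeq_fluctProd_mem (ws : List (List κ)) : meanSeq (Γ.fluctProd ws) ∈ boundedSeq :=
  (Γ.momentsBounded ((ws.map List.length).sum + 1)).meanSeq_mem (Nat.lt_succ_self _)

end GaussianMatrixModel

/-! # Fluctuations negligible in mean -/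

section MeanAbs

variable {ι : Type*} [Fintype ι]

/-- The `L¹` seminorm of a polynomial in independent standard Gaussian variables. -/
noncomputable def meanAbs : Seminorm ℂ (MvPolynomial ι ℂ) :=
  Seminorm.of (fun p => ∫ g, ‖realEval g p‖ ∂stdGaussianPi ι)
    (fun p q => by
      simp only [map_add]
      exact (integral_mono ((integrable_realEval p).add (integrable_realEval q)).norm
        ((integrable_realEval p).norm.add (integrable_realEval q).norm)
        fun g => norm_add_le _ _).trans_eq
          (integral_add (integrable_realEval p).norm (integrable_realEval q).norm))
    fun a p => by simp [integral_const_mul]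

theorem meanAbs_apply (p : MvPolynomial ι ℂ) :
    meanAbs p = ∫ g, ‖realEval g p‖ ∂stdGaussianPi ι := rfl

theorem norm_phaseIntegral_le {q : MvPolynomial ι ℂ} (hq : IsPhase q) (p : MvPolynomial ι ℂ) :
    ‖phaseIntegral hq p‖ ≤ meanAbs p :=
  (norm_integral_le_integral_norm _).trans_eq (by simp [hq.norm_exp, meanAbs_apply])

theorem gaussianMean_star (p : MvPolynomial ι ℂ) :
    gaussianMean (star p) = star (gaussianMean p) := by
  simp only [gaussianMean_apply, realEval_star]
  exact integral_conj

theorem star_fluct (p : MvPolynomial ι ℂ) : star (fluct p) = fluct (star p) := by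
  rw [fluct_apply, fluct_apply, star_sub, gaussianMean_star,
    star_mvPolynomial_def (MvPolynomial.C _), MvPolynomial.map_C]
  rfl

theorem gaussianMean_mul_star (p : MvPolynomial ι ℂ) :
    gaussianMean (p * star p) = (∫ g, ‖realEval g p‖ ^ 2 ∂stdGaussianPi ι : ℝ) := by
  simp only [gaussianMean_apply, realEval_mul_star, integral_complex_ofReal]

theorem integrable_norm_realEval_sq (p : MvPolynomial ι ℂ) :
    Integrable (fun g => ‖realEval g p‖ ^ 2) (stdGaussianPi ι) := by
  simpa [realEval_mul_star] using (integrable_realEval (p * star p)).norm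

theorem meanAbs_mul_le (p q : MvPolynomial ι ℂ) :
    meanAbs (p * q) ≤ ‖gaussianMean (p * star p)‖ + ‖gaussianMean (q * star q)‖ := by
  have hnorm (p : MvPolynomial ι ℂ) : ‖gaussianMean (p * star p)‖ =
      ∫ g, ‖realEval g p‖ ^ 2 ∂stdGaussianPi ι := by
    rw [gaussianMean_mul_star, Complex.norm_real]
    exact Real.norm_of_nonneg (integral_nonneg fun g => sq_nonneg _)
  rw [hnorm, hnorm,
    ← integral_add (integrable_norm_realEval_sq p) (integrable_norm_realEval_sq q)]
  refine integral_mono (integrable_realEval _).norm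
    ((integrable_norm_realEval_sq p).add (integrable_norm_realEval_sq q)) fun g => ?_
  simp only [map_mul, norm_mul]
  nlinarith [sq_nonneg (‖realEval g p‖ - ‖realEval g q‖), sq_nonneg ‖realEval g p‖,
    sq_nonneg ‖realEval g q‖]

end MeanAbs

section NullSeq

open Asymptotics

variable {ι : ℕ → Type*} [∀ n, Fintype (ι n)]

/-- Sequences of polynomials tending to zero in mean. -/
def nullSeq : Submodule ℂ (PolySeq ι) where
  carrier := {p | Tendsto (fun n => meanAbs (p n)) atTop (nhds 0)}
  add_mem' hp hq := squeeze_zero (fun _ => apply_nonneg _ _) (fun _ => map_add_le_add _ _ _)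
    (by simpa using Tendsto.add hp hq)
  zero_mem' := by simp
  smul_mem' a p hp := by simpa [map_smul_eq_mul] using Tendsto.const_mul ‖a‖ hp

theorem mem_nullSeq {p : PolySeq ι} :
    p ∈ nullSeq ↔ Tendsto (fun n => meanAbs (p n)) atTop (nhds 0) := Iff.rfl

theorem smul_mem_nullSeq {a : ℕ → ℂ} {p : PolySeq ι} (ha : Tendsto a atTop (nhds 0))
    (hp : (fun n => meanAbs (p n)) =O[atTop] fun _ => (1 : ℝ)) :
    (fun n => a n • p n) ∈ nullSeq := by
  have h := (((isLittleO_one_iff ℝ).2 ha).norm_left.mul_isBigO hp)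
  simp only [mul_one] at h
  simpa only [mem_nullSeq, map_smul_eq_mul] using (isLittleO_one_iff ℝ).1 h

theorem C_mem_nullSeq {a : ℕ → ℂ} (ha : Tendsto a atTop (nhds 0)) :
    (fun n => MvPolynomial.C (a n) : PolySeq ι) ∈ nullSeq := by
  simpa [mem_nullSeq, meanAbs_apply] using ha.norm

theorem tendsto_mul_boundedSeq {a b : ℕ → ℂ} (ha : Tendsto a atTop (nhds 0))
    (hb : b ∈ boundedSeq) : Tendsto (a * b) atTop (nhds 0) := by
  have h := ((isLittleO_one_iff ℝ).2 ha).mul_isBigO hb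
  simp only [mul_one] at h
  exact (isLittleO_one_iff ℝ).1 h

theorem star_fluctTrace (Z : MatrixSeq ι) : star (fluctTrace Z) = fluctTrace (star Z) := by
  funext n
  simp [fluctTrace_apply, star_fluct, Matrix.star_eq_conjTranspose]

theorem isBigO_meanAbs_mul {p q : PolySeq ι} (hp : meanSeq (p * star p) ∈ boundedSeq)
    (hq : meanSeq (q * star q) ∈ boundedSeq) :
    (fun n => meanAbs ((p * q) n)) =O[atTop] fun _ => (1 : ℝ) := by
  refine IsBigO.trans (IsBigO.of_bound 1 (Eventually.of_forall fun n => ?_))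
    (hp.norm_left.add hq.norm_left)
  rw [one_mul, Real.norm_of_nonneg (apply_nonneg _ _)]
  exact (meanAbs_mul_le _ _).trans (le_abs_self _)

end NullSeq

namespace GaussianMatrixModel

open Finset Asymptotics

variable {κ : Type*} {ι : ℕ → Type*} [∀ n, Fintype (ι n)] (Γ : GaussianMatrixModel κ ι)

/-- The sequences of noncommutative polynomials in the letters, with coefficients independent of
the size of the matrices. -/
noncomputable def wordAlgebra : Subalgebra ℂ (MatrixSeq ι) := Algebra.adjoin ℂ (Set.range Γ.matrix)

theorem toSubmodule_wordAlgebra :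
    Γ.wordAlgebra.toSubmodule = Submodule.span ℂ (Set.range Γ.word) := by
  rw [wordAlgebra, Algebra.adjoin_eq_span, ← FreeMonoid.mrange_lift]
  exact congrArg _ (congrArg Set.range (funext fun w => FreeMonoid.lift_apply _ _))

theorem aeval_matrix_mem_wordAlgebra (ε : κ) (p : Polynomial ℂ) :
    Polynomial.aeval (Γ.matrix ε) p ∈ Γ.wordAlgebra :=
  Algebra.adjoin_mono (Set.singleton_subset_iff.2 (Set.mem_range_self ε))
    (Polynomial.aeval_mem_adjoin_singleton _ _)

theorem star_matrix (ε : κ) : star (Γ.matrix ε) = Γ.matrix (Γ.adj ε) :=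
  funext fun _ => Γ.conjTranspose_matrix ε

variable {Γ} in
theorem star_mem_wordAlgebra {Z : MatrixSeq ι} (hZ : Z ∈ Γ.wordAlgebra) :
    star Z ∈ Γ.wordAlgebra := by
  have hstar : star Z ∈ Algebra.adjoin ℂ (star (Set.range Γ.matrix)) := by
    rw [← Subalgebra.star_adjoin_comm]
    simpa [wordAlgebra] using hZ
  refine Algebra.adjoin_mono ?_ hstar
  rintro W ⟨ε, hε⟩
  exact ⟨Γ.adj ε, by rw [← star_matrix, hε, star_star]⟩

variable {Γ} {Z Z' : MatrixSeq ι}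

theorem meanSeq_fluctTrace_mul_fluctTrace_mem (hZ : Z ∈ Γ.wordAlgebra)
    (hZ' : Z' ∈ Γ.wordAlgebra) :
    meanSeq (fluctTrace Z * fluctTrace Z') ∈ boundedSeq := by
  rw [← Subalgebra.mem_toSubmodule, toSubmodule_wordAlgebra] at hZ hZ'
  refine LinearMap.BilinMap.apply_apply_mem_of_mem_span boundedSeq.toSubmodule _ _
    (((LinearMap.mul ℂ (PolySeq ι)).compl₁₂ fluctTrace fluctTrace).compr₂ meanSeq) ?_ Z Z' hZ hZ'
  rintro _ ⟨v, rfl⟩ _ ⟨w, rfl⟩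
  simpa using Γ.meanSeq_fluctProd_mem [v, w]

theorem meanSeq_fluctTrace_mul_star_mem (hZ : Z ∈ Γ.wordAlgebra) :
    meanSeq (fluctTrace Z * star (fluctTrace Z)) ∈ boundedSeq := by
  rw [star_fluctTrace]
  exact meanSeq_fluctTrace_mul_fluctTrace_mem hZ (star_mem_wordAlgebra hZ)

theorem isBigO_meanAbs_fluctTrace_mul_fluctTrace (hZ : Z ∈ Γ.wordAlgebra)
    (hZ' : Z' ∈ Γ.wordAlgebra) :
    (fun n => meanAbs (fluctTrace Z n * fluctTrace Z' n)) =O[atTop] fun _ => (1 : ℝ) :=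
  isBigO_meanAbs_mul (meanSeq_fluctTrace_mul_star_mem hZ) (meanSeq_fluctTrace_mul_star_mem hZ')

theorem isBigO_meanAbs_fluctTrace (hZ : Z ∈ Γ.wordAlgebra) :
    (fun n => meanAbs (fluctTrace Z n)) =O[atTop] fun _ => (1 : ℝ) := by
  simpa using isBigO_meanAbs_mul (q := 1) (meanSeq_fluctTrace_mul_star_mem hZ)
    (by simp)

theorem smul_trace_sub_mem_nullSeq (hZ : Z ∈ Γ.wordAlgebra) {z : ℂ}
    (hz : Tendsto (meanTrace Z) atTop (nhds z)) :
    (fun n : ℕ => (n : ℂ)⁻¹ • (Z n).trace) - algebraMap ℂ (PolySeq ι) z ∈ nullSeq := by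
  have hsplit : (fun n : ℕ => (n : ℂ)⁻¹ • (Z n).trace) - algebraMap ℂ (PolySeq ι) z =
      (fun n => invSeq n • fluctTrace Z n) + fun n => MvPolynomial.C (meanTrace Z n - z) := by
    funext n
    simp [fluctTrace_apply, fluct_apply, meanTrace_apply, invSeq, smul_sub,
      MvPolynomial.smul_eq_C_mul]
  rw [hsplit]
  exact add_mem (smul_mem_nullSeq tendsto_invSeq (isBigO_meanAbs_fluctTrace hZ))
    (C_mem_nullSeq (tendsto_sub_nhds_zero_iff.2 hz))

theorem smul_fluct_mul_mem_nullSeq (hZ : Z ∈ Γ.wordAlgebra) (hZ' : Z' ∈ Γ.wordAlgebra) :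
    (fun n : ℕ => (n : ℂ)⁻¹ • fluct (fluctTrace Z n * fluctTrace Z' n)) ∈ nullSeq := by
  have hsplit : (fun n : ℕ => (n : ℂ)⁻¹ • fluct (fluctTrace Z n * fluctTrace Z' n)) =
      (fun n => invSeq n • (fluctTrace Z n * fluctTrace Z' n)) -
        fun n => MvPolynomial.C ((invSeq * meanSeq (fluctTrace Z * fluctTrace Z')) n) := by
    funext n
    simp [fluct_apply, invSeq, smul_sub, MvPolynomial.smul_eq_C_mul, meanSeq_apply]
  rw [hsplit]
  exact sub_mem
    (smul_mem_nullSeq tendsto_invSeq (isBigO_meanAbs_fluctTrace_mul_fluctTrace hZ hZ'))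
    (C_mem_nullSeq (tendsto_mul_boundedSeq tendsto_invSeq
      (meanSeq_fluctTrace_mul_fluctTrace_mem hZ hZ')))

namespace IsSplit

variable {σ : Type*} {ε : κ} {A : MatrixSeq ι} {s : Finset σ} {c l l' : σ → ℂ}
  {L R : σ → MatrixSeq ι}

theorem tendsto_meanTrace_matrix_mul (h : Γ.IsSplit ε A s c L R)
    (hL : ∀ r ∈ s, L r ∈ Γ.wordAlgebra) (hR : ∀ r ∈ s, R r ∈ Γ.wordAlgebra)
    (hl : ∀ r ∈ s, Tendsto (meanTrace (L r)) atTop (nhds (l r)))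
    (hl' : ∀ r ∈ s, Tendsto (meanTrace (R r)) atTop (nhds (l' r))) :
    Tendsto (meanTrace (Γ.matrix ε * A)) atTop (nhds (∑ r ∈ s, c r * (l r * l' r))) := by
  rw [h.meanTrace_matrix_mul, show (∑ r ∈ s, c r * (l r * l' r)) =
    ∑ r ∈ s, c r • (l r * l' r + 0) by simp]
  have hterm (r) (hr : r ∈ s) := (((hl r hr).mul (hl' r hr)).add (tendsto_mul_boundedSeq
    (tendsto_mul_boundedSeq tendsto_invSeq invSeq_mem_boundedSeq)
    (meanSeq_fluctTrace_mul_fluctTrace_mem (hL r hr) (hR r hr)))).const_smul (c r)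
  exact (tendsto_finsetSum s hterm).congr fun n => by simp [Finset.sum_apply, mul_add]

theorem fluct_div_sub_mem_nullSeq (h : Γ.IsSplit ε A s c L R)
    (hL : ∀ r ∈ s, L r ∈ Γ.wordAlgebra) (hR : ∀ r ∈ s, R r ∈ Γ.wordAlgebra)
    (hl : ∀ r ∈ s, Tendsto (meanTrace (L r)) atTop (nhds (l r)))
    (hl' : ∀ r ∈ s, Tendsto (meanTrace (R r)) atTop (nhds (l' r))) :
    (fun n => fluct (Γ.div ε (A n))) -
      fluctTrace (∑ r ∈ s, c r • (l r • R r + l' r • L r)) ∈ nullSeq := by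
  have hsplit : (fun n => fluct (Γ.div ε (A n))) -
      fluctTrace (∑ r ∈ s, c r • (l r • R r + l' r • L r)) = ∑ r ∈ s, c r •
        ((fun n : ℕ => (n : ℂ)⁻¹ • fluct (fluctTrace (L r) n * fluctTrace (R r) n)) +
          (fun n => (meanTrace (L r) n - l r) • fluctTrace (R r) n) +
          fun n => (meanTrace (R r) n - l' r) • fluctTrace (L r) n) := by
    funext n
    simp only [h.fluct_div, map_sum, map_add, map_smul, Pi.sub_apply, Finset.sum_apply,
      Pi.smul_apply, Pi.add_apply, ← sum_sub_distrib]
    exact sum_congr rfl fun r _ => by module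
  rw [hsplit]
  refine sum_mem fun r hr => nullSeq.smul_mem _ (add_mem (add_mem
    (smul_fluct_mul_mem_nullSeq (hL r hr) (hR r hr)) ?_) ?_)
  · exact smul_mem_nullSeq (tendsto_sub_nhds_zero_iff.2 (hl r hr))
      (isBigO_meanAbs_fluctTrace (hR r hr))
  · exact smul_mem_nullSeq (tendsto_sub_nhds_zero_iff.2 (hl' r hr))
      (isBigO_meanAbs_fluctTrace (hL r hr))

end IsSplit

end GaussianMatrixModel

/-! # Asymptotic orthogonality of Chebyshev polynomials -/

namespace GaussianMatrixModel

open Finset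

variable {κ : Type*} {ι : ℕ → Type*} [∀ n, Fintype (ι n)] (Γ : GaussianMatrixModel κ ι)

/-- The limit of the normalised expected trace of the product of the Chebyshev polynomials of the
second kind of degree `j` in the letter `ε` and of degree `k` in the letter `δ`. -/
noncomputable def chebyshevLim (ε δ : κ) (j k : ℕ) : ℂ := if j = k then Γ.cov ε δ ^ k else 0

theorem chebyshevLim_zero_right (ε δ : κ) (j : ℕ) :
    Γ.chebyshevLim ε δ j 0 = if j = 0 then 1 else 0 := by
  rw [chebyshevLim, pow_zero]

theorem chebyshevU_mem_wordAlgebra (ε : κ) (j : ℕ) : Γ.chebyshevU ε j ∈ Γ.wordAlgebra :=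
  Γ.aeval_matrix_mem_wordAlgebra ε _

theorem meanTrace_mul_comm (A B : MatrixSeq ι) : meanTrace (A * B) = meanTrace (B * A) := by
  funext n
  simp only [meanTrace_apply, Pi.mul_apply, Matrix.trace_mul_comm (A n)]

theorem sum_chebyshevLim_left (ε δ : κ) (j k : ℕ) :
    ∑ r ∈ range (j + 1), Γ.cov ε ε * (Γ.chebyshevLim ε ε r 0 * Γ.chebyshevLim ε δ (j - r) k) =
      Γ.cov ε ε * Γ.chebyshevLim ε δ j k := by
  simp [chebyshevLim_zero_right]

theorem sum_chebyshevLim_right (ε δ : κ) (j k : ℕ) :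
    ∑ r ∈ range k, Γ.cov ε δ * (Γ.chebyshevLim ε δ j r * Γ.chebyshevLim δ δ (k - 1 - r) 0) =
      Γ.chebyshevLim ε δ (j + 1) k := by
  cases k with
  | zero => simp [chebyshevLim]
  | succ k =>
    rw [sum_range_succ, sum_eq_zero fun r hr => ?_]
    · simp [chebyshevLim, pow_succ']
    · have : k - r ≠ 0 := by grind
      simp [chebyshevLim_zero_right, this]

theorem tendsto_meanTrace_matrix_mul_chebyshevU_mul {j k : ℕ}
    (ih : ∀ (ε δ : κ) (i l : ℕ), i + l ≤ j + k →
      Tendsto (meanTrace (Γ.chebyshevU ε i * Γ.chebyshevU δ l)) atTop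
        (nhds (Γ.chebyshevLim ε δ i l))) (ε δ : κ) :
    Tendsto (meanTrace (Γ.matrix ε * (Γ.chebyshevU ε j * Γ.chebyshevU δ k))) atTop
      (nhds (∑ r ∈ range j, Γ.cov ε ε *
        (Γ.chebyshevLim ε ε r 0 * Γ.chebyshevLim ε δ (j - 1 - r) k) +
          Γ.chebyshevLim ε δ (j + 1) k)) := by
  have ih_one (ε : κ) (i : ℕ) (hi : i ≤ j + k) :
      Tendsto (meanTrace (Γ.chebyshevU ε i)) atTop (nhds (Γ.chebyshevLim ε ε i 0)) := by
    simpa using ih ε ε i 0 (by simpa using hi)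
  have hlim := ((Γ.isSplit_chebyshevU ε ε j).mul
    (Γ.isSplit_chebyshevU ε δ k)).tendsto_meanTrace_matrix_mul
      (l := Sum.elim (fun r => Γ.chebyshevLim ε ε r 0) (Γ.chebyshevLim ε δ j))
      (l' := Sum.elim (fun r => Γ.chebyshevLim ε δ (j - 1 - r) k)
        fun r => Γ.chebyshevLim δ δ (k - 1 - r) 0) ?_ ?_ ?_ ?_
  · simpa [sum_disjSum, sum_chebyshevLim_right] using hlim
  · rintro (r | r) -
    · exact Γ.chebyshevU_mem_wordAlgebra ε r
    · exact mul_mem (Γ.chebyshevU_mem_wordAlgebra ε j) (Γ.chebyshevU_mem_wordAlgebra δ r)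
  · rintro (r | r) -
    · exact mul_mem (Γ.chebyshevU_mem_wordAlgebra ε _) (Γ.chebyshevU_mem_wordAlgebra δ k)
    · exact Γ.chebyshevU_mem_wordAlgebra δ _
  · rintro (r | r) hr <;> simp only [inl_mem_disjSum, inr_mem_disjSum, mem_range] at hr
    · exact ih_one ε r (by omega)
    · exact ih ε δ j r (by omega)
  · rintro (r | r) hr <;> simp only [inl_mem_disjSum, inr_mem_disjSum, mem_range] at hr
    · exact ih ε δ _ k (by omega)
    · exact ih_one δ _ (by omega)

theorem tendsto_meanTrace_chebyshevU_succ_mul {j k : ℕ}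
    (ih : ∀ (ε δ : κ) (i l : ℕ), i + l ≤ j + k →
      Tendsto (meanTrace (Γ.chebyshevU ε i * Γ.chebyshevU δ l)) atTop
        (nhds (Γ.chebyshevLim ε δ i l))) (ε δ : κ) :
    Tendsto (meanTrace (Γ.chebyshevU ε (j + 1) * Γ.chebyshevU δ k)) atTop
      (nhds (Γ.chebyshevLim ε δ (j + 1) k)) := by
  have hlim := Γ.tendsto_meanTrace_matrix_mul_chebyshevU_mul ih ε δ
  cases j with
  | zero => simpa using hlim
  | succ j =>
    rw [Nat.add_sub_cancel, sum_chebyshevLim_left] at hlim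
    have hsub := hlim.sub ((ih ε δ j k (by omega)).const_smul (Γ.cov ε ε))
    rw [smul_eq_mul, add_sub_cancel_left] at hsub
    rwa [chebyshevU_add_two, sub_mul, mul_assoc, smul_mul_assoc, map_sub, map_smul]

theorem tendsto_meanTrace_chebyshevU_mul (ε δ : κ) (j k : ℕ) :
    Tendsto (meanTrace (Γ.chebyshevU ε j * Γ.chebyshevU δ k)) atTop
      (nhds (Γ.chebyshevLim ε δ j k)) := by
  induction hN : j + k using Nat.strong_induction_on generalizing ε δ j k with
  | _ N ih =>
  match j, k with
  | 0, 0 => simpa [chebyshevLim] using tendsto_meanTrace_one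
  | j + 1, k =>
    exact Γ.tendsto_meanTrace_chebyshevU_succ_mul
      (fun ε δ i l h => ih (i + l) (by omega) ε δ i l rfl) ε δ
  | 0, k + 1 =>
    rw [meanTrace_mul_comm]
    simpa [chebyshevLim] using Γ.tendsto_meanTrace_chebyshevU_succ_mul (k := 0)
      (fun ε δ i l h => ih (i + l) (by omega) ε δ i l rfl) δ ε

theorem tendsto_meanTrace_chebyshevU (ε : κ) (j : ℕ) :
    Tendsto (meanTrace (Γ.chebyshevU ε j)) atTop (nhds (if j = 0 then 1 else 0)) := by
  simpa [chebyshevLim_zero_right] using Γ.tendsto_meanTrace_chebyshevU_mul ε ε j 0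

/-- The Chebyshev polynomial of the first kind of degree `k` in the letter `ε`, rescaled by the
variance of this letter. -/
noncomputable def chebyshevT (ε : κ) (k : ℕ) : MatrixSeq ι :=
  Polynomial.aeval (Γ.matrix ε) (Polynomial.dickson 1 (Γ.cov ε ε) k)

theorem chebyshevT_one (ε : κ) : Γ.chebyshevT ε 1 = Γ.matrix ε := by
  simp [chebyshevT]

theorem chebyshevT_add_two (ε : κ) (k : ℕ) :
    Γ.chebyshevT ε (k + 2) = Γ.matrix ε * Γ.chebyshevU ε (k + 1) -
      (2 * Γ.cov ε ε) • Γ.chebyshevU ε k := by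
  rw [chebyshevT, dickson_one_add_two_eq, map_sub, map_mul _ Polynomial.X,
    map_mul _ (Polynomial.C _), Polynomial.aeval_X, Polynomial.aeval_C, ← Algebra.smul_def]
  rfl

theorem sum_smul_chebyshevU (ε : κ) (k : ℕ) :
    ∑ r ∈ range k, Γ.cov ε ε • ((if r = 0 then (1 : ℂ) else 0) • Γ.chebyshevU ε (k - 1 - r) +
      (if k - 1 - r = 0 then (1 : ℂ) else 0) • Γ.chebyshevU ε r) =
      Γ.matrix ε * Γ.chebyshevU ε k - Γ.chebyshevT ε (k + 1) := by
  cases k with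
  | zero => simp [chebyshevT_one]
  | succ k =>
    have hfirst : ∑ r ∈ range (k + 1),
        (if r = 0 then (1 : ℂ) else 0) • Γ.chebyshevU ε (k - r) = Γ.chebyshevU ε k := by
      simp
    have hlast : ∑ r ∈ range (k + 1),
        (if k - r = 0 then (1 : ℂ) else 0) • Γ.chebyshevU ε r = Γ.chebyshevU ε k := by
      rw [← sum_range_reflect]
      refine Eq.trans (sum_congr rfl fun r hr => ?_) hfirst
      rw [mem_range] at hr
      rw [show k + 1 - 1 - r = k - r by omega, show k - (k - r) = r by omega]
    rw [chebyshevT_add_two, sub_sub_cancel, Nat.add_sub_cancel, ← smul_sum, sum_add_distrib,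
      hfirst, hlast, ← two_smul ℂ, smul_smul, mul_comm]

theorem fluct_div_chebyshevU_sub_mem_nullSeq (ε : κ) (k : ℕ) :
    (fun n => fluct (Γ.div ε (Γ.chebyshevU ε k n))) -
      fluctTrace (Γ.matrix ε * Γ.chebyshevU ε k - Γ.chebyshevT ε (k + 1)) ∈ nullSeq := by
  rw [← sum_smul_chebyshevU]
  exact (Γ.isSplit_chebyshevU ε ε k).fluct_div_sub_mem_nullSeq
    (fun r _ => Γ.chebyshevU_mem_wordAlgebra ε r) (fun r _ => Γ.chebyshevU_mem_wordAlgebra ε _)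
    (fun r _ => Γ.tendsto_meanTrace_chebyshevU ε r)
    (fun r _ => Γ.tendsto_meanTrace_chebyshevU ε _)

end GaussianMatrixModel

/-! # Characteristic functions in the limit -/

/-- Stability of the differential equation `φ' = - s v φ` of a Gaussian characteristic function. -/
theorem norm_sub_exp_le_of_hasDerivAt {φ φ' : ℝ → ℂ} {v : ℂ} {a : ℝ}
    (hφ : ∀ s, HasDerivAt φ (φ' s) s) (h0 : φ 0 = 1)
    (h : ∀ s ∈ Set.Ico (0 : ℝ) 1, ‖φ' s + s * v * φ s‖ ≤ a) :
    ‖φ 1 - Complex.exp (-(v / 2))‖ ≤ a * Real.exp ‖v‖ * Real.exp ‖v‖ := by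
  have hexp (z : ℂ) (hz : ‖z‖ ≤ ‖v‖) : ‖Complex.exp z‖ ≤ Real.exp ‖v‖ := by
    rw [Complex.norm_exp]
    exact Real.exp_le_exp.2 ((Complex.re_le_norm z).trans hz)
  have hderiv (s : ℝ) : HasDerivAt (fun s : ℝ => φ s * Complex.exp ((s : ℂ) ^ 2 * v / 2))
      ((φ' s + s * v * φ s) * Complex.exp ((s : ℂ) ^ 2 * v / 2)) s := by
    have hexponent : HasDerivAt (fun s : ℝ => (s : ℂ) ^ 2 * v / 2) (s * v) s := by
      refine ((((Complex.ofRealCLM.hasDerivAt (x := s)).pow 2).mul_const v).div_const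
        2).congr_deriv ?_
      simp
      ring
    refine ((hφ s).mul hexponent.cexp).congr_deriv ?_
    ring
  have hexponent_le (s : ℝ) (hs : s ∈ Set.Icc (0 : ℝ) 1) : ‖(s : ℂ) ^ 2 * v / 2‖ ≤ ‖v‖ := by
    have hsq : ‖(s : ℂ)‖ ^ 2 ≤ 1 := by
      rw [Complex.norm_real, Real.norm_eq_abs, abs_of_nonneg hs.1]
      nlinarith [hs.1, hs.2]
    rw [norm_div, norm_mul, norm_pow, RCLike.norm_ofNat]
    nlinarith [norm_nonneg v, mul_le_mul_of_nonneg_right hsq (norm_nonneg v)]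
  have hsegment := norm_image_sub_le_of_norm_deriv_le_segment_01'
    (fun s _ => (hderiv s).hasDerivWithinAt) (C := a * Real.exp ‖v‖) fun s hs => by
      rw [norm_mul]
      exact mul_le_mul (h s hs) (hexp _ (hexponent_le s ⟨hs.1, hs.2.le⟩)) (norm_nonneg _)
        ((norm_nonneg _).trans (h s hs))
  have hfactor : φ 1 - Complex.exp (-(v / 2)) = (φ 1 * Complex.exp (((1 : ℝ) : ℂ) ^ 2 * v / 2) -
      φ 0 * Complex.exp (((0 : ℝ) : ℂ) ^ 2 * v / 2)) * Complex.exp (-(v / 2)) := by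
    rw [h0, sub_mul, mul_assoc, ← Complex.exp_add]
    simp
  rw [hfactor, norm_mul]
  refine mul_le_mul hsegment (hexp _ ?_) (norm_nonneg _) ((norm_nonneg _).trans hsegment)
  rw [norm_neg, norm_div, RCLike.norm_ofNat]
  linarith [norm_nonneg v]

theorem hasDerivAt_phaseIntegral_one {ι : Type*} [Fintype ι] {w : MvPolynomial ι ℂ}
    (hq : ∀ s : ℝ, IsPhase ((Complex.I * s) • w)) (s : ℝ) :
    HasDerivAt (fun s => phaseIntegral (hq s) 1) (phaseIntegral (hq s) (Complex.I • w)) s := by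
  have hderiv (g : ι → ℝ) (s : ℝ) : HasDerivAt
      (fun s : ℝ => realEval g 1 * Complex.exp (realEval g ((Complex.I * s) • w)))
      (realEval g (Complex.I • w) * Complex.exp (realEval g ((Complex.I * s) • w))) s := by
    have hexponent : HasDerivAt (fun s : ℝ => realEval g ((Complex.I * s) • w))
        (realEval g (Complex.I • w)) s := by
      simpa [smul_eq_mul] using
        ((Complex.ofRealCLM.hasDerivAt (x := s)).const_mul Complex.I).mul_const (realEval g w)
    refine (hexponent.cexp.const_mul (realEval g 1)).congr_deriv ?_
    rw [map_one]
    ring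
  exact (hasDerivAt_integral_of_dominated_loc_of_deriv_le (μ := stdGaussianPi ι)
    (bound := fun g => ‖realEval g (Complex.I • w)‖) univ_mem
    (Eventually.of_forall fun s => ((hq s).integrable 1).aestronglyMeasurable)
    ((hq s).integrable 1) ((hq s).integrable _).aestronglyMeasurable
    (ae_of_all _ fun g s _ => by rw [norm_mul, (hq s).norm_exp, mul_one])
    (integrable_realEval _).norm (ae_of_all _ fun g s _ => hderiv g s)).2

section SteinDual

open Finset

variable {ι : ℕ → Type*} [∀ n, Fintype (ι n)]

/-- Asymptotic Gaussian integration by parts: integrating `F n` against a phase `exp q` amounts to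
integrating `D n q`, up to an error which tends to zero uniformly in `q`. -/
def IsSteinDual (F : PolySeq ι)
    (D : ∀ n, Derivation ℂ (MvPolynomial (ι n) ℂ) (MvPolynomial (ι n) ℂ)) : Prop :=
  ∃ r ∈ nullSeq, ∀ (n : ℕ) (q : MvPolynomial (ι n) ℂ) (hq : IsPhase q),
    phaseIntegral hq (F n) = phaseIntegral hq (r n + D n q)

theorem IsSteinDual.tendsto_phaseIntegral_one {W : PolySeq ι}
    {D : ∀ n, Derivation ℂ (MvPolynomial (ι n) ℂ) (MvPolynomial (ι n) ℂ)}
    (hW : IsSteinDual W D) {v : ℂ}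
    (hv : (fun n => D n (W n)) - algebraMap ℂ (PolySeq ι) v ∈ nullSeq)
    (hq : ∀ (n : ℕ) (s : ℝ), IsPhase ((Complex.I * s) • W n)) :
    Tendsto (fun n => phaseIntegral (hq n 1) 1) atTop (nhds (Complex.exp (-(v / 2)))) := by
  obtain ⟨r, hr, hparts⟩ := hW
  set e : PolySeq ι := (fun n => D n (W n)) - algebraMap ℂ (PolySeq ι) v with he
  have hode (n : ℕ) (s : ℝ) :
      phaseIntegral (hq n s) (Complex.I • W n) + s * v * phaseIntegral (hq n s) 1 =
        Complex.I * phaseIntegral (hq n s) (r n) - s * phaseIntegral (hq n s) (e n) := by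
    have hen : phaseIntegral (hq n s) (e n) =
        phaseIntegral (hq n s) (D n (W n)) - v * phaseIntegral (hq n s) 1 := by
      rw [he, Pi.sub_apply, Pi.algebraMap_apply, Algebra.algebraMap_eq_smul_one, map_sub, map_smul,
        smul_eq_mul]
    rw [map_smul, hparts, map_add, Derivation.map_smul, map_smul, hen, smul_eq_mul, smul_eq_mul]
    linear_combination (s * phaseIntegral (hq n s) (D n (W n))) * Complex.I_sq
  have hbound (n : ℕ) : ‖phaseIntegral (hq n 1) 1 - Complex.exp (-(v / 2))‖ ≤
      (meanAbs (r n) + meanAbs (e n)) * Real.exp ‖v‖ * Real.exp ‖v‖ := by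
    refine norm_sub_exp_le_of_hasDerivAt (fun s => hasDerivAt_phaseIntegral_one (hq n) s) ?_ ?_
    · simp [phaseIntegral_apply]
    · intro s hs
      rw [hode]
      refine (norm_sub_le _ _).trans (add_le_add ?_ ?_)
      · rw [norm_mul, Complex.norm_I, one_mul]
        exact norm_phaseIntegral_le _ _
      · rw [norm_mul, Complex.norm_real, Real.norm_eq_abs, abs_of_nonneg hs.1]
        exact (mul_le_of_le_one_left (norm_nonneg _) hs.2.le).trans (norm_phaseIntegral_le _ _)
  rw [tendsto_iff_norm_sub_tendsto_zero]
  refine squeeze_zero (fun n => norm_nonneg _) hbound ?_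
  simpa using ((Tendsto.add hr hv).mul_const (Real.exp ‖v‖)).mul_const (Real.exp ‖v‖)

variable {σ : Type*} {s : Finset σ} {F : σ → PolySeq ι}
  {D : σ → ∀ n, Derivation ℂ (MvPolynomial (ι n) ℂ) (MvPolynomial (ι n) ℂ)} (η : σ → ℂ)

theorem IsSteinDual.sum_smul (h : ∀ i ∈ s, IsSteinDual (F i) (D i)) :
    IsSteinDual (∑ i ∈ s, η i • F i) fun n => ∑ i ∈ s, η i • D i n := by
  choose! r hr hparts using h
  refine ⟨∑ i ∈ s, η i • r i, sum_mem fun i hi => nullSeq.smul_mem _ (hr i hi), fun n q hq => ?_⟩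
  simp only [Finset.sum_apply, Pi.smul_apply, derivation_sum_apply, Derivation.smul_apply, map_sum,
    map_smul, ← sum_add_distrib, ← smul_add, map_add]
  exact sum_congr rfl fun i hi => by rw [hparts i hi n q hq, map_add]

theorem tendsto_phaseIntegral_sum_smul_one {c : σ → σ → ℂ}
    (hF : ∀ i ∈ s, IsSteinDual (F i) (D i))
    (hc : ∀ i ∈ s, ∀ j ∈ s,
      (fun n => D i n (F j n)) - algebraMap ℂ (PolySeq ι) (c i j) ∈ nullSeq)
    (hq : ∀ (n : ℕ) (x : ℝ), IsPhase ((Complex.I * x) • (∑ i ∈ s, η i • F i) n)) :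
    Tendsto (fun n => phaseIntegral (hq n 1) 1) atTop
      (nhds (Complex.exp (-((∑ i ∈ s, ∑ j ∈ s, η i * η j * c i j) / 2)))) := by
  refine (IsSteinDual.sum_smul η hF).tendsto_phaseIntegral_one ?_ hq
  have hsplit : (fun n => (∑ i ∈ s, η i • D i n) ((∑ i ∈ s, η i • F i) n)) -
      algebraMap ℂ (PolySeq ι) (∑ i ∈ s, ∑ j ∈ s, η i * η j * c i j) =
      ∑ i ∈ s, η i • ∑ j ∈ s, η j •
        ((fun n => D i n (F j n)) - algebraMap ℂ (PolySeq ι) (c i j)) := by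
    funext n
    rw [Pi.sub_apply, derivation_sum_apply]
    simp only [Derivation.smul_apply, Pi.sub_apply, Finset.sum_apply, Pi.smul_apply, map_sum,
      Derivation.map_smul, smul_sub, sum_sub_distrib, Algebra.algebraMap_eq_smul_one, smul_sum,
      smul_smul, mul_assoc]
    congr 1
    exact sum_congr rfl fun i _ => sum_congr rfl fun j _ => by rw [mul_comm (η i)]
  rw [hsplit]
  exact sum_mem fun i hi => nullSeq.smul_mem _ (sum_mem fun j hj =>
    nullSeq.smul_mem _ (hc i hi j hj))

end SteinDual

namespace GaussianMatrixModel

open Finset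

variable {κ : Type*} {ι : ℕ → Type*} [∀ n, Fintype (ι n)] (Γ : GaussianMatrixModel κ ι)

theorem isSteinDual_fluctTrace_chebyshevT (ε : κ) (k : ℕ) :
    IsSteinDual (fluctTrace (Γ.chebyshevT ε (k + 1)))
      fun n => Γ.grad ε (Γ.chebyshevU ε k n) := by
  refine ⟨_, Γ.fluct_div_chebyshevU_sub_mem_nullSeq ε k, fun n q hq => ?_⟩
  have hloop := Γ.phaseIntegral_fluct_trace_matrix_mul hq ε (Γ.chebyshevU ε k n) 1
  simp only [mul_one, one_mul, Derivation.map_one_eq_zero, add_zero, map_add] at hloop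
  simp only [map_sub, Pi.sub_apply, map_add, fluctTrace_apply (Γ.matrix ε * _), Pi.mul_apply,
    hloop]
  ring

theorem grad_fluctTrace_chebyshevT (ε δ : κ) (k l n : ℕ) :
    Γ.grad ε (Γ.chebyshevU ε k n) (fluctTrace (Γ.chebyshevT δ (l + 1)) n) =
      ((l + 1) * Γ.cov ε δ) • (n : ℂ)⁻¹ • ((Γ.chebyshevU ε k * Γ.chebyshevU δ l) n).trace := by
  rw [fluctTrace_apply, grad_fluct, chebyshevT, grad_trace_aeval, derivative_dickson_one, map_mul,
    map_natCast, ← nsmul_eq_mul, Pi.smul_apply, mul_smul_comm, Matrix.trace_smul,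
    ← Nat.cast_smul_eq_nsmul ℂ, smul_smul, smul_smul]
  congr 1
  push_cast
  ring

theorem grad_fluctTrace_chebyshevT_sub_mem_nullSeq (ε δ : κ) (k l : ℕ) :
    (fun n => Γ.grad ε (Γ.chebyshevU ε k n) (fluctTrace (Γ.chebyshevT δ (l + 1)) n)) -
      algebraMap ℂ (PolySeq ι) (if k = l then (l + 1) * Γ.cov ε δ ^ (l + 1) else 0) ∈ nullSeq := by
  have hnull := nullSeq.smul_mem ((l + 1) * Γ.cov ε δ) (smul_trace_sub_mem_nullSeq
    (mul_mem (Γ.chebyshevU_mem_wordAlgebra ε k) (Γ.chebyshevU_mem_wordAlgebra δ l))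
    (Γ.tendsto_meanTrace_chebyshevU_mul ε δ k l))
  have hlim : (if k = l then ((l : ℂ) + 1) * Γ.cov ε δ ^ (l + 1) else 0) =
      ((l + 1) * Γ.cov ε δ) * Γ.chebyshevLim ε δ k l := by
    rw [chebyshevLim, mul_ite, mul_zero, pow_succ', mul_assoc]
  rw [hlim, map_mul, ← Algebra.smul_def]
  simpa only [smul_sub, Pi.smul_def, grad_fluctTrace_chebyshevT] using hnull

/-- The centred traces of Chebyshev polynomials of the first kind are asymptotically Gaussian, and
independent for different degrees. -/
theorem tendsto_phaseIntegral_fluctTrace_chebyshevT [Fintype κ] (η : κ × ℕ → ℂ) (m : ℕ)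
    (hq : ∀ (n : ℕ) (x : ℝ), IsPhase ((Complex.I * x) •
      (∑ i ∈ univ ×ˢ range m, η i • fluctTrace (Γ.chebyshevT i.1 (i.2 + 1))) n)) :
    Tendsto (fun n => phaseIntegral (hq n 1) 1) atTop
      (nhds (Complex.exp (-((∑ k ∈ range m, ∑ ε, ∑ δ,
        η (ε, k) * η (δ, k) * ((k + 1) * Γ.cov ε δ ^ (k + 1))) / 2)))) := by
  have hlim := tendsto_phaseIntegral_sum_smul_one η
    (fun i _ => Γ.isSteinDual_fluctTrace_chebyshevT i.1 i.2)
    (fun i _ j _ => Γ.grad_fluctTrace_chebyshevT_sub_mem_nullSeq i.1 j.1 i.2 j.2) hq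
  convert hlim using 5
  simp only [sum_product, mul_ite, mul_zero]
  rw [sum_comm]
  refine sum_congr rfl fun ε _ => sum_congr rfl fun k hk => sum_congr rfl fun δ _ => ?_
  rw [sum_ite_eq, if_pos hk]

end GaussianMatrixModel

/-! # The elliptic Ginibre ensemble as a Gaussian model -/

section GUE

variable {n : ℕ}

/-- The coefficient of `g (i, j)` in the entry `(i, j)` of `gueMatrix n g`. -/
noncomputable def gueWeight (i j : Fin n) : ℂ :=
  if i = j then 1 else (√2 : ℂ)⁻¹ * if i < j then 1 else -Complex.I

/-- The coefficient of `g (j, i)` in the entry `(i, j)` of `gueMatrix n g`, for `i ≠ j`. -/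
noncomputable def gueWeightSwap (i j : Fin n) : ℂ :=
  if i = j then 0 else (√2 : ℂ)⁻¹ * if i < j then Complex.I else 1

theorem gueMatrix_apply (g : Fin n × Fin n → ℝ) (i j : Fin n) :
    gueMatrix n g i j = gueWeight i j * g (i, j) + gueWeightSwap i j * g (j, i) := by
  rw [gueMatrix, Matrix.of_apply, gueWeight, gueWeightSwap]
  split_ifs with hij
  · simp [hij]
  all_goals ring

theorem inv_sqrt_two_sq : (√2 : ℂ)⁻¹ ^ 2 = 1 / 2 := by
  rw [inv_pow, ← Complex.ofReal_pow, Real.sq_sqrt zero_le_two, Complex.ofReal_ofNat, one_div]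

theorem gueWeight_sq_add_gueWeightSwap_sq (i j : Fin n) :
    gueWeight i j * gueWeight i j + gueWeightSwap i j * gueWeightSwap i j =
      if i = j then 1 else 0 := by
  rw [gueWeight, gueWeightSwap]
  split_ifs
  · ring
  all_goals linear_combination (√2 : ℂ)⁻¹ ^ 2 * Complex.I_sq

theorem gueWeight_mul_gueWeightSwap_add (i j : Fin n) :
    gueWeight i j * gueWeightSwap j i + gueWeightSwap i j * gueWeight j i =
      if i = j then 0 else 1 := by
  rcases lt_trichotomy i j with h | rfl | h
  · simp only [gueWeight, gueWeightSwap, h.ne, h.ne', h, h.not_gt, if_false, if_true]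
    linear_combination 2 * inv_sqrt_two_sq - (√2 : ℂ)⁻¹ ^ 2 * Complex.I_sq
  · simp [gueWeightSwap]
  · simp only [gueWeight, gueWeightSwap, h.ne, h.ne', h, h.not_gt, if_false, if_true]
    linear_combination 2 * inv_sqrt_two_sq - (√2 : ℂ)⁻¹ ^ 2 * Complex.I_sq

/-- The coefficient of the Gaussian variable `p` in the entry `(i, j)` of the GUE matrix. -/
noncomputable def gueCoeff (i j : Fin n) (p : Fin n × Fin n) : ℂ :=
  gueMatrix n (Pi.single p 1) i j

theorem gueCoeff_eq (i j : Fin n) (p : Fin n × Fin n) :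
    gueCoeff i j p =
      (if p = (i, j) then gueWeight i j else 0) + if p = (j, i) then gueWeightSwap i j else 0 := by
  simp [gueCoeff, gueMatrix_apply, Pi.single_apply, eq_comm, apply_ite Complex.ofReal]

theorem gueMatrix_apply_eq_sum (g : Fin n × Fin n → ℝ) (i j : Fin n) :
    gueMatrix n g i j = ∑ p, gueCoeff i j p * (g p : ℂ) := by
  simp [gueMatrix_apply, gueCoeff_eq, add_mul, Finset.sum_add_distrib]

theorem star_gueCoeff (i j : Fin n) (p : Fin n × Fin n) :
    star (gueCoeff i j p) = gueCoeff j i p :=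
  (gueMatrix_isHermitian n (Pi.single p 1)).apply j i

theorem sum_gueCoeff_mul_gueCoeff (i j k l : Fin n) :
    ∑ p, gueCoeff i j p * gueCoeff k l p = if i = l ∧ j = k then 1 else 0 := by
  have hsum : ∑ p, gueCoeff i j p * gueCoeff k l p =
      (if k = i ∧ l = j then gueWeight i j * gueWeight k l + gueWeightSwap i j * gueWeightSwap k l
        else 0) +
      if l = i ∧ k = j then gueWeight i j * gueWeightSwap k l + gueWeightSwap i j * gueWeight k l
        else 0 := by
    simp only [gueCoeff_eq, add_mul, mul_add, Finset.sum_add_distrib, ite_mul, zero_mul, mul_ite,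
      mul_zero, Finset.sum_ite_eq', Finset.mem_univ, if_true, Prod.mk.injEq,
      @and_comm (k = j) (l = i), @and_comm (l = j) (k = i)]
    split_ifs <;> ring
  simp only [hsum, @eq_comm _ i l, @eq_comm _ j k]
  by_cases hswap : l = i ∧ k = j
  · obtain ⟨rfl, rfl⟩ := hswap
    simp only [and_self, if_true, gueWeight_mul_gueWeightSwap_add]
    by_cases hlk : l = k
    · subst hlk
      simp only [and_self, if_true, gueWeight_sq_add_gueWeightSwap_sq, add_zero]
    · simp [hlk]
  · by_cases hsame : k = i ∧ l = j
    · obtain ⟨rfl, rfl⟩ := hsame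
      have hkl : k ≠ l := fun h => hswap ⟨h.symm, h⟩
      rw [if_pos ⟨rfl, rfl⟩, gueWeight_sq_add_gueWeightSwap_sq, if_neg hkl, if_neg hswap,
        if_neg hswap, add_zero]
    · rw [if_neg hsame, if_neg hswap, if_neg hswap, add_zero]

end GUE

/-- The indices of the real Gaussian variables entering an elliptic Ginibre matrix. -/
abbrev EllIndex (n : ℕ) : Type := (Fin n × Fin n) ⊕ (Fin n × Fin n)

/-- The coefficient of the Gaussian variable `p` in the entry `(i, j)` of the normalised matrix
`A / √n` (for `ε = true`) or of its adjoint (for `ε = false`). -/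
noncomputable def ellCoeff (t : ℝ) {n : ℕ} (ε : Bool) (i j : Fin n) : EllIndex n → ℂ :=
  Sum.elim (fun p => (√n : ℂ)⁻¹ * √((1 + t) / 2) * gueCoeff i j p)
    fun p => (√n : ℂ)⁻¹ * ((if ε then Complex.I else -Complex.I) * √((1 - t) / 2)) * gueCoeff i j p

/-- The covariance of `A / √n` and its adjoint, up to the factor `n⁻¹`. -/
def ellCov (t : ℝ) (ε δ : Bool) : ℂ := if ε = δ then t else 1

theorem star_ellCoeff (t : ℝ) {n : ℕ} (ε : Bool) (i j : Fin n) (p : EllIndex n) :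
    star (ellCoeff t ε i j p) = ellCoeff t (!ε) j i p := by
  rcases p with p | p
  · simp [ellCoeff, ← star_gueCoeff i j]
  · cases ε <;> simp [ellCoeff, ← star_gueCoeff i j]

theorem sqrt_mul_self_ofReal {x : ℝ} (hx : 0 ≤ x) : (√x : ℂ) * √x = x := by
  rw [← Complex.ofReal_mul, Real.mul_self_sqrt hx]

theorem sum_ellCoeff_mul_ellCoeff {t : ℝ} (ht : t ∈ Set.Icc (-1 : ℝ) 1) {n : ℕ} (ε δ : Bool)
    (i j k l : Fin n) :
    ∑ p, ellCoeff t ε i j p * ellCoeff t δ k l p =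
      (n : ℂ)⁻¹ * ellCov t ε δ * if i = l ∧ j = k then 1 else 0 := by
  have hn : (√n : ℂ)⁻¹ * (√n : ℂ)⁻¹ = (n : ℂ)⁻¹ := by
    rw [← mul_inv, sqrt_mul_self_ofReal n.cast_nonneg, Complex.ofReal_natCast]
  have hcov : (√((1 + t) / 2) : ℂ) * √((1 + t) / 2) +
      (if ε then Complex.I else -Complex.I) * (if δ then Complex.I else -Complex.I) *
        (√((1 - t) / 2) * √((1 - t) / 2)) = ellCov t ε δ := by
    rw [sqrt_mul_self_ofReal (by linarith [ht.1]), sqrt_mul_self_ofReal (by linarith [ht.2])]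
    cases ε <;> cases δ <;> simp [ellCov] <;> ring
  rw [← sum_gueCoeff_mul_gueCoeff, Fintype.sum_sum_type, Finset.mul_sum, ← Finset.sum_add_distrib]
  refine Finset.sum_congr rfl fun p _ => ?_
  rw [← hn, ← hcov, ellCoeff, ellCoeff, Sum.elim_inl, Sum.elim_inl, Sum.elim_inr, Sum.elim_inr]
  ring

/-- The letters `true` and `false` stand for `A / √n` and its adjoint, where `A` is the elliptic
Ginibre matrix at `t`. -/
noncomputable def ellipticModel {t : ℝ} (ht : t ∈ Set.Icc (-1 : ℝ) 1) :
    GaussianMatrixModel Bool EllIndex where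
  coeff := ellCoeff t
  adj := not
  cov := ellCov t
  sum_coeff_mul_coeff := sum_ellCoeff_mul_ellCoeff ht
  star_coeff := star_ellCoeff t

/-! # Weak convergence in countable products -/

section ProductConvergence

open Topology Finset

theorem exists_monotone_isOpen_iUnion_preimage_restrict {E : ℕ → Type*}
    [∀ k, TopologicalSpace (E k)] {G : Set (∀ k, E k)} (hG : IsOpen G) :
    ∃ O : ∀ m, Set (∀ k : range m, E k), (∀ m, IsOpen (O m)) ∧
      Monotone (fun m => (range m).restrict ⁻¹' O m) ∧ ⋃ m, (range m).restrict ⁻¹' O m = G := by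
  let O : ∀ m, Set (∀ k : range m, E k) := fun m =>
    ⋃₀ {U | IsOpen U ∧ (range m).restrict ⁻¹' U ⊆ G}
  refine ⟨O, fun m => isOpen_sUnion fun U hU => hU.1, ?_, ?_⟩
  · rintro m m' hm x ⟨U, hU, hx⟩
    exact ⟨restrict₂ (range_mono hm) ⁻¹' U, ⟨hU.1.preimage (continuous_restrict₂ _), hU.2⟩, hx⟩
  · refine Set.Subset.antisymm (Set.iUnion_subset ?_) fun x hx => ?_
    · rintro m x ⟨U, hU, hx⟩
      exact hU.2 hx
    · obtain ⟨I, u, hu, hsub⟩ := isOpen_pi_iff.1 hG x hx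
      obtain ⟨m, hm⟩ := I.exists_nat_subset_range
      refine Set.mem_iUnion.2 ⟨m, ⋂ i : I, (fun y => y ⟨i, hm i.2⟩) ⁻¹' u i, ⟨?_, ?_⟩, ?_⟩
      · exact isOpen_iInter_of_finite fun i =>
          (hu i i.2).1.preimage (continuous_apply (⟨i, hm i.2⟩ : range m))
      · exact fun y hy => hsub fun i hi => Set.mem_iInter.1 hy ⟨i, hi⟩
      · exact Set.mem_iInter.2 fun i => (hu i i.2).2

theorem tendsto_of_tendsto_map_restrict {E : ℕ → Type*} [∀ k, TopologicalSpace (E k)]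
    [∀ k, TopologicalSpace.PseudoMetrizableSpace (E k)] [∀ k, SecondCountableTopology (E k)]
    [∀ k, MeasurableSpace (E k)] [∀ k, BorelSpace (E k)]
    {μ : ℕ → ProbabilityMeasure (∀ k, E k)} {ν : ProbabilityMeasure (∀ k, E k)}
    (h : ∀ m, Tendsto (fun n => (μ n).map (measurable_restrict (range m)).aemeasurable) atTop
      (𝓝 (ν.map (measurable_restrict (range m)).aemeasurable))) :
    Tendsto μ atTop (𝓝 ν) := by
  refine tendsto_of_forall_isOpen_le_liminf' fun G hG => ?_
  obtain ⟨O, hO, hmono, hunion⟩ := exists_monotone_isOpen_iUnion_preimage_restrict hG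
  have hcylinder (κ : ProbabilityMeasure (∀ k, E k)) (m : ℕ) :
      (κ.map (measurable_restrict (range m)).aemeasurable : Measure (∀ k : range m, E k)) (O m) =
        (κ : Measure (∀ k, E k)) ((range m).restrict ⁻¹' O m) :=
    Measure.map_apply (measurable_restrict _) (hO m).measurableSet
  have hliminf (m : ℕ) : (ν : Measure (∀ k, E k)) ((range m).restrict ⁻¹' O m) ≤
      atTop.liminf fun n => (μ n : Measure (∀ k, E k)) G := by
    have hmarginal := ProbabilityMeasure.le_liminf_measure_open_of_tendsto (h m) (hO m)
    simp only [hcylinder] at hmarginal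
    exact hmarginal.trans (liminf_le_liminf (Eventually.of_forall fun n =>
      measure_mono
        ((Set.subset_iUnion (fun m => (range m).restrict ⁻¹' O m) m).trans hunion.subset)))
  calc (ν : Measure (∀ k, E k)) G
      = ⨆ m, (ν : Measure (∀ k, E k)) ((range m).restrict ⁻¹' O m) := by
        rw [← hmono.measure_iUnion, hunion]
    _ ≤ _ := iSup_le hliminf

theorem tendsto_pi_of_tendsto_charFun {ι : Type*} [Fintype ι] {E : ι → Type*}
    [∀ i, NormedAddCommGroup (E i)] [∀ i, InnerProductSpace ℝ (E i)]
    [∀ i, FiniteDimensional ℝ (E i)] [∀ i, MeasurableSpace (E i)] [∀ i, BorelSpace (E i)]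
    {μ : ℕ → ProbabilityMeasure (∀ i, E i)} {ν : ∀ i, Measure (E i)}
    [∀ i, IsProbabilityMeasure (ν i)]
    (h : ∀ ξ : ∀ i, E i, Tendsto (fun n => ∫ x, Complex.exp
      (((∑ i, inner ℝ (x i) (ξ i) : ℝ) : ℂ) * Complex.I) ∂(μ n : Measure (∀ i, E i)))
      atTop (𝓝 (∏ i, charFun (ν i) (ξ i)))) :
    Tendsto μ atTop (𝓝 ⟨Measure.pi ν, inferInstance⟩) := by
  have htoLp : Measurable (WithLp.toLp 2 : (∀ i, E i) → PiLp 2 E) := by fun_prop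
  have hofLp : Continuous (WithLp.ofLp : PiLp 2 E → ∀ i, E i) := PiLp.continuous_ofLp 2 _
  have hback (κ : ProbabilityMeasure (∀ i, E i)) :
      (κ.map htoLp.aemeasurable).map hofLp.aemeasurable = κ := by
    refine Subtype.ext ((Measure.map_map hofLp.measurable htoLp).trans ?_)
    exact Measure.map_id
  let ν' : ProbabilityMeasure (∀ i, E i) := ⟨Measure.pi ν, inferInstance⟩
  have hlim : Tendsto (fun n => (μ n).map htoLp.aemeasurable) atTop
      (𝓝 (ν'.map htoLp.aemeasurable)) := by
    refine ProbabilityMeasure.tendsto_of_tendsto_charFun fun ξ => ?_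
    have hcharFun : charFun (ν'.map htoLp.aemeasurable : Measure (PiLp 2 E)) ξ =
        ∏ i, charFun (ν i) (ξ i) := charFun_pi ξ
    rw [hcharFun]
    refine (h ξ).congr fun n => ?_
    rw [ProbabilityMeasure.toMeasure_map, charFun_apply,
      integral_map htoLp.aemeasurable (by fun_prop)]
    simp only [PiLp.inner_apply]
  have hmap := ProbabilityMeasure.tendsto_map_of_tendsto_of_continuous _ _ hlim hofLp
  simpa only [hback] using hmap

theorem tendsto_infinitePi_of_tendsto_charFun {E : ℕ → Type*}
    [∀ k, NormedAddCommGroup (E k)] [∀ k, InnerProductSpace ℝ (E k)]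
    [∀ k, FiniteDimensional ℝ (E k)] [∀ k, MeasurableSpace (E k)] [∀ k, BorelSpace (E k)]
    {μ : ℕ → ProbabilityMeasure (∀ k, E k)} {ν : ∀ k, Measure (E k)}
    [∀ k, IsProbabilityMeasure (ν k)]
    (h : ∀ (m : ℕ) (ξ : ∀ k, E k), Tendsto (fun n => ∫ x, Complex.exp
      (((∑ k ∈ range m, inner ℝ (x k) (ξ k) : ℝ) : ℂ) * Complex.I) ∂(μ n : Measure (∀ k, E k)))
      atTop (𝓝 (∏ k ∈ range m, charFun (ν k) (ξ k)))) :
    Tendsto μ atTop (𝓝 ⟨Measure.infinitePi ν, inferInstance⟩) := by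
  refine tendsto_of_tendsto_map_restrict fun m => ?_
  have hlimit : ProbabilityMeasure.map ⟨Measure.infinitePi ν, inferInstance⟩
      (measurable_restrict (range m)).aemeasurable =
        ⟨Measure.pi fun k : range m => ν k, inferInstance⟩ :=
    Subtype.ext (Measure.infinitePi_map_restrict ν)
  rw [hlimit]
  refine tendsto_pi_of_tendsto_charFun fun ξ => ?_
  let ζ : ∀ k, E k := fun k => if hk : k ∈ range m then ξ ⟨k, hk⟩ else 0
  have hζ (k : range m) : ζ k = ξ k := dif_pos k.2
  have hexp : Continuous fun x : ∀ k : range m, E k =>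
      Complex.exp (((∑ k, inner ℝ (x k) (ξ k) : ℝ) : ℂ) * Complex.I) := by fun_prop
  have hlim := h m ζ
  rw [← prod_coe_sort] at hlim
  simp only [hζ] at hlim
  refine hlim.congr fun n => ?_
  rw [ProbabilityMeasure.toMeasure_map, integral_map (measurable_restrict _).aemeasurable
    hexp.aestronglyMeasurable]
  refine integral_congr_ae (ae_of_all _ fun x => ?_)
  simp only [Finset.restrict]
  rw [← sum_coe_sort]
  simp only [hζ]

end ProductConvergence

/-! # Centred Gaussian measures on the complex plane -/

section ComplexGaussian

open scoped NNReal

/-- The law of `x + i y` with `x` and `y` independent centred Gaussian variables of variances `v`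
and `w`. -/
noncomputable def complexGaussian (v w : ℝ≥0) : Measure ℂ :=
  ((gaussianReal 0 v).prod (gaussianReal 0 w)).map Complex.equivRealProdCLM.symm

variable (v w : ℝ≥0)

instance isGaussian_complexGaussian : IsGaussian (complexGaussian v w) := by
  have hfst : HasGaussianLaw (Prod.fst : ℝ × ℝ → ℝ)
      ((gaussianReal 0 v).prod (gaussianReal 0 w)) :=
    HasLaw.hasGaussianLaw (μ := gaussianReal 0 v) ⟨by fun_prop, measurePreserving_fst.map_eq⟩
  have hsnd : HasGaussianLaw (Prod.snd : ℝ × ℝ → ℝ)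
      ((gaussianReal 0 v).prod (gaussianReal 0 w)) :=
    HasLaw.hasGaussianLaw (μ := gaussianReal 0 w) ⟨by fun_prop, measurePreserving_snd.map_eq⟩
  have hpair := IndepFun.hasGaussianLaw hfst hsnd
    (indepFun_prod (X := id) (Y := id) measurable_id measurable_id)
  exact (hpair.map_equiv Complex.equivRealProdCLM.symm).isGaussian_map

theorem integral_complexGaussian {f : ℂ → ℂ} (hf : Continuous f) :
    ∫ z, f z ∂complexGaussian v w =
      ∫ p : ℝ × ℝ, f (p.1 + p.2 * Complex.I) ∂(gaussianReal 0 v).prod (gaussianReal 0 w) := by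
  rw [complexGaussian, integral_map (by fun_prop) hf.aestronglyMeasurable]
  simp only [Complex.equivRealProdCLM_symm_apply]

theorem integral_ofReal_gaussianReal : ∫ x : ℝ, (x : ℂ) ∂gaussianReal 0 v = 0 := by
  rw [integral_complex_ofReal, integral_id_gaussianReal, Complex.ofReal_zero]

theorem integral_ofReal_sq_gaussianReal : ∫ x : ℝ, (x : ℂ) ^ 2 ∂gaussianReal 0 v = v := by
  have hvar : ∫ x : ℝ, x ^ 2 ∂gaussianReal 0 v = v := by
    rw [← variance_fun_id_gaussianReal (μ := 0),
      variance_of_integral_eq_zero (by fun_prop) integral_id_gaussianReal]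
  simp only [← Complex.ofReal_pow, integral_complex_ofReal, hvar]

theorem integrable_ofReal_gaussianReal : Integrable (fun x : ℝ => (x : ℂ)) (gaussianReal 0 v) :=
  (memLp_one_iff_integrable.1 (memLp_id_gaussianReal' 1 (by simp))).ofReal

theorem integrable_ofReal_sq_gaussianReal :
    Integrable (fun x : ℝ => (x : ℂ) ^ 2) (gaussianReal 0 v) := by
  simpa using (memLp_id_gaussianReal' (μ := 0) (v := v) 2 (by simp)).integrable_sq.ofReal (𝕜 := ℂ)

theorem integral_id_complexGaussian : ∫ z, z ∂complexGaussian v w = 0 := by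
  rw [integral_complexGaussian v w continuous_id', integral_add
      ((integrable_ofReal_gaussianReal v).comp_fst _)
      (((integrable_ofReal_gaussianReal w).mul_const _).comp_snd _),
    integral_fun_fst (fun x : ℝ => (x : ℂ)), integral_fun_snd (fun x : ℝ => (x : ℂ) * Complex.I),
    integral_mul_const, integral_ofReal_gaussianReal, integral_ofReal_gaussianReal]
  simp

theorem integral_quadratic_prod_gaussianReal (a b c : ℂ) :
    ∫ p : ℝ × ℝ, (a * (p.1 : ℂ) ^ 2 + b * (p.2 : ℂ) ^ 2 + c * ((p.1 : ℂ) * (p.2 : ℂ)))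
      ∂(gaussianReal 0 v).prod (gaussianReal 0 w) = a * v + b * w := by
  have hfst := ((integrable_ofReal_sq_gaussianReal v).const_mul a).comp_fst (gaussianReal 0 w)
  have hsnd := ((integrable_ofReal_sq_gaussianReal w).const_mul b).comp_snd (gaussianReal 0 v)
  have hmul := ((integrable_ofReal_gaussianReal v).mul_prod
    (integrable_ofReal_gaussianReal w)).const_mul c
  rw [integral_add (hfst.fun_add hsnd) hmul, integral_add hfst hsnd,
    integral_fun_fst (fun x : ℝ => a * (x : ℂ) ^ 2),
    integral_fun_snd (fun x : ℝ => b * (x : ℂ) ^ 2), integral_const_mul c,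
    integral_prod_mul (fun x : ℝ => (x : ℂ)) (fun x : ℝ => (x : ℂ))]
  simp [integral_const_mul, integral_ofReal_sq_gaussianReal, integral_ofReal_gaussianReal]

theorem integral_sq_complexGaussian : ∫ z, z ^ 2 ∂complexGaussian v w = (v : ℂ) - (w : ℂ) := by
  rw [integral_complexGaussian v w (by fun_prop), sub_eq_add_neg, ← one_mul (v : ℂ),
    ← neg_one_mul (w : ℂ), ← integral_quadratic_prod_gaussianReal v w 1 (-1) (2 * Complex.I)]
  refine integral_congr_ae (ae_of_all _ fun p => ?_)
  linear_combination (p.2 : ℂ) ^ 2 * Complex.I_sq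

theorem integral_norm_sq_complexGaussian : ∫ z, ‖z‖ ^ 2 ∂complexGaussian v w = v + w := by
  rw [← Complex.ofReal_inj, ← integral_complex_ofReal,
    integral_complexGaussian v w (by fun_prop), Complex.ofReal_add, ← one_mul ((v : ℝ) : ℂ),
    ← one_mul ((w : ℝ) : ℂ)]
  refine Eq.trans (integral_congr_ae (ae_of_all _ fun p => ?_))
    (integral_quadratic_prod_gaussianReal v w 1 1 0)
  simp only [Complex.sq_norm, Complex.normSq_add_mul_I]
  push_cast
  ring

theorem charFun_complexGaussian (ξ : ℂ) : charFun (complexGaussian v w) ξ =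
    Complex.exp (-(v * (ξ.re : ℂ) ^ 2 + w * (ξ.im : ℂ) ^ 2) / 2) := by
  have hprod : charFun (complexGaussian v w) ξ =
      charFun (gaussianReal 0 v) ξ.re * charFun (gaussianReal 0 w) ξ.im := by
    rw [charFun_apply, integral_complexGaussian v w (by fun_prop), charFun_apply_real,
      charFun_apply_real, ← integral_prod_mul]
    refine integral_congr_ae (ae_of_all _ fun p => ?_)
    have hinner : inner ℝ ((p.1 : ℂ) + p.2 * Complex.I) ξ = ξ.re * p.1 + ξ.im * p.2 := by
      simp [Complex.inner, mul_comm]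
    simp only [← Complex.exp_add, hinner]
    push_cast
    ring_nf
  rw [hprod, charFun_gaussianReal, charFun_gaussianReal, ← Complex.exp_add]
  congr 1
  push_cast
  ring

end ComplexGaussian

/-! # Traces of elliptic Ginibre matrices -/

theorem star_polynomial_aeval {R A : Type*} [CommSemiring R] [StarRing R] [Semiring A] [StarRing A]
    [Algebra R A] [StarModule R A] (x : A) (p : Polynomial R) :
    star (Polynomial.aeval x p) = Polynomial.aeval (star x) (p.map (starRingEnd R)) := by
  induction p using Polynomial.induction_on' with
  | add p q hp hq => rw [map_add, star_add, hp, hq, Polynomial.map_add, map_add]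
  | monomial k a =>
    rw [Polynomial.map_monomial, Polynomial.aeval_monomial, Polynomial.aeval_monomial, star_mul,
      star_pow, ← algebraMap_star_comm, starRingEnd_apply, Algebra.commutes]

namespace GaussianMatrixModel

variable {κ : Type*} {ι : ℕ → Type*} [∀ n, Fintype (ι n)] (Γ : GaussianMatrixModel κ ι)

theorem star_cov (ε δ : κ) : star (Γ.cov ε δ) = Γ.cov (Γ.adj ε) (Γ.adj δ) := by
  have hcov (ε δ : κ) : Γ.cov ε δ = ∑ p, Γ.coeff (n := 1) ε 0 0 p * Γ.coeff δ 0 0 p := by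
    simp [Γ.sum_coeff_mul_coeff]
  simp only [hcov, star_sum, star_mul', Γ.star_coeff]

theorem star_chebyshevT (ε : κ) (k : ℕ) :
    star (Γ.chebyshevT ε k) = Γ.chebyshevT (Γ.adj ε) k := by
  rw [chebyshevT, star_polynomial_aeval, star_matrix, Polynomial.map_dickson, starRingEnd_apply,
    star_cov, chebyshevT]

theorem fluctTrace_chebyshevT_zero (ε : κ) : fluctTrace (Γ.chebyshevT ε 0) = 0 := by
  rw [chebyshevT, Polynomial.dickson_zero, Nat.cast_one, ← map_ofNat Polynomial.C,
    ← map_one Polynomial.C, ← map_sub, Polynomial.aeval_C, Algebra.algebraMap_eq_smul_one,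
    map_smul, fluctTrace_one, smul_zero]

end GaussianMatrixModel

section EllipticGinibre

open Finset

theorem measurable_traceStat (n : ℕ) (t : ℝ) (k : ℕ) : Measurable (traceStat n t k) := by
  have hentry (i j : Fin n) : Measurable fun M : Matrix (Fin n) (Fin n) ℂ => M i j :=
    (measurable_pi_apply j).comp (measurable_pi_apply i)
  have hpow (m : ℕ) : ∀ i j : Fin n, Measurable fun M : Matrix (Fin n) (Fin n) ℂ =>
      (((√n : ℂ)⁻¹ • M) ^ m) i j := by
    induction m with
    | zero => simp
    | succ m ih =>
      intro i j
      simp only [pow_succ, Matrix.mul_apply, Matrix.smul_apply, smul_eq_mul]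
      exact Finset.measurable_fun_sum _ fun s _ => (ih i s).mul ((hentry s j).const_mul _)
  unfold traceStat
  simp only [Polynomial.aeval_eq_sum_range, Matrix.trace, Matrix.diag_apply, Matrix.sum_apply,
    Matrix.smul_apply, smul_eq_mul]
  exact (Finset.measurable_fun_sum _ fun i _ => Finset.measurable_fun_sum _ fun m _ =>
    (hpow m i i).const_mul _).add_const _

theorem identDistrib_centredTrace {Ω Ω' : Type*} [MeasurableSpace Ω] [MeasurableSpace Ω']
    {P : Measure Ω} {P' : Measure Ω'} {n : ℕ} {A : Ω → Matrix (Fin n) (Fin n) ℂ}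
    {A' : Ω' → Matrix (Fin n) (Fin n) ℂ} (h : IdentDistrib A A' P P') (t : ℝ) :
    IdentDistrib (fun ω k => centredTrace P n t A k ω) (fun ω k => centredTrace P' n t A' k ω)
      P P' := by
  have hmean (k : ℕ) : ∫ ω, traceStat n t k (A ω) ∂P = ∫ ω, traceStat n t k (A' ω) ∂P' :=
    (h.comp (measurable_traceStat n t k)).integral_eq
  simp only [centredTrace, hmean]
  exact h.comp (u := fun M k => traceStat n t k M - ∫ ω, traceStat n t k (A' ω) ∂P')
    (measurable_pi_lambda _ fun k => (measurable_traceStat n t k).sub_const _)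

/-- The elliptic Ginibre matrix as a function of independent standard Gaussian variables. -/
noncomputable def ellipticSample (t : ℝ) (n : ℕ) (g : EllIndex n → ℝ) : Matrix (Fin n) (Fin n) ℂ :=
  ellipticCombination n t (gueMatrix n fun p => g (Sum.inl p), gueMatrix n fun p => g (Sum.inr p))

theorem hasLaw_ellipticSample (t : ℝ) (n : ℕ) :
    HasLaw (ellipticSample t n) (ellipticGinibreLaw n t) (stdGaussianPi (EllIndex n)) := by
  have hsplit := measurePreserving_sumPiEquivProdPi (ι := Fin n × Fin n) (ι' := Fin n × Fin n)
    (X := fun _ => ℝ) (fun _ => gaussianReal 0 1)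
  have hgue : MeasurePreserving (gueMatrix n) (Measure.pi fun _ => gaussianReal 0 1) (gueLaw n) :=
    ⟨measurable_gueMatrix n, rfl⟩
  have hcomb : MeasurePreserving (ellipticCombination n t) ((gueLaw n).prod (gueLaw n))
      (ellipticGinibreLaw n t) := ⟨measurable_ellipticCombination n t, rfl⟩
  exact (hcomb.comp ((hgue.prod hgue).comp hsplit)).hasLaw

variable {t : ℝ} (ht : t ∈ Set.Icc (-1 : ℝ) 1)

theorem map_realEval_ellipticModel_matrix (n : ℕ) (g : EllIndex n → ℝ) :
    ((ellipticModel ht).matrix true n).map (realEval g) = (√n : ℂ)⁻¹ • ellipticSample t n g := by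
  ext i j
  simp only [Matrix.map_apply, GaussianMatrixModel.matrix, ellipticModel, Matrix.of_apply,
    Fintype.sum_sum_type, ellCoeff, Sum.elim_inl, Sum.elim_inr, map_add, map_sum,
    map_mul (realEval g), realEval_C, realEval_X, Matrix.smul_apply, ellipticSample,
    ellipticCombination, Matrix.add_apply, gueMatrix_apply_eq_sum, smul_eq_mul, mul_add, mul_sum,
    if_true]
  congr 1 <;> exact sum_congr rfl fun p _ => by ring

theorem traceStat_ellipticSample (n k : ℕ) (g : EllIndex n → ℝ) :
    traceStat n t k (ellipticSample t n g) =
      realEval g ((ellipticModel ht).chebyshevT true k n).trace +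
        if k = 2 then (n : ℂ) * (t : ℂ) else 0 := by
  have hcheb : (ellipticModel ht).chebyshevT true k n =
      Polynomial.aeval ((ellipticModel ht).matrix true n) (modChebyshev t k) :=
    (Polynomial.aeval_algHom_apply (Pi.evalAlgHom ℂ (PolyMatrix EllIndex) n) _ _).symm
  have haeval := Polynomial.aeval_algHom_apply (realEval g).mapMatrix
    ((ellipticModel ht).matrix true n) (modChebyshev t k)
  rw [AlgHom.mapMatrix_apply, map_realEval_ellipticModel_matrix] at haeval
  rw [traceStat, haeval, hcheb, AlgHom.mapMatrix_apply, AddMonoidHom.map_trace]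

include ht in
theorem integrable_traceStat (n k : ℕ) :
    Integrable (traceStat n t k) (ellipticGinibreLaw n t) := by
  have hlaw := hasLaw_ellipticSample t n
  have hintegrable : Integrable (fun g => traceStat n t k (ellipticSample t n g))
      (stdGaussianPi (EllIndex n)) := by
    simp only [traceStat_ellipticSample ht]
    exact (integrable_realEval _).add (integrable_const _)
  rw [← hlaw.map_eq]
  exact (integrable_map_measure (measurable_traceStat n t k).aestronglyMeasurable
    hlaw.aemeasurable).2 hintegrable

theorem centredTrace_ellipticSample (n k : ℕ) (g : EllIndex n → ℝ) :
    centredTrace (stdGaussianPi (EllIndex n)) n t (ellipticSample t n) k g =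
      realEval g (fluctTrace ((ellipticModel ht).chebyshevT true k) n) := by
  simp only [centredTrace, traceStat_ellipticSample ht]
  rw [integral_add (integrable_realEval _) (integrable_const _), ← gaussianMean_apply,
    fluctTrace_apply, fluct_apply, map_sub, realEval_C]
  simp

end EllipticGinibre

/-! # The limiting Gaussian family -/

section LimitLaw

open Finset

/-- The real linear form `x ↦ ∑ k, Re (x (k + 1) * conj (ξ (k + 1)))` has coefficient
`dualCoeff ξ (true, k)` at `x (k + 1)` and `dualCoeff ξ (false, k)` at its conjugate. -/
noncomputable def dualCoeff (ξ : ℕ → ℂ) (i : Bool × ℕ) : ℂ :=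
  if i.1 then starRingEnd ℂ (ξ (i.2 + 1)) / 2 else ξ (i.2 + 1) / 2

theorem inner_eq_dualCoeff (ξ : ℕ → ℂ) (k : ℕ) (z : ℂ) :
    (inner ℝ z (ξ (k + 1)) : ℂ) = dualCoeff ξ (true, k) * z + dualCoeff ξ (false, k) * star z := by
  rw [dualCoeff, dualCoeff, if_pos rfl, if_neg Bool.false_ne_true, Complex.inner,
    Complex.re_eq_add_conj, map_mul, Complex.conj_conj, Complex.star_def]
  ring

/-- The variance of the real part of the limit of the `k`-th centred trace. -/
noncomputable def limVarRe (t : ℝ) (k : ℕ) : NNReal := (k * (1 + t ^ k) / 2).toNNReal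

/-- The variance of the imaginary part of the limit of the `k`-th centred trace. -/
noncomputable def limVarIm (t : ℝ) (k : ℕ) : NNReal := (k * (1 - t ^ k) / 2).toNNReal

/-- The law of the limit of the `k`-th centred trace. -/
noncomputable def limitLaw (t : ℝ) (k : ℕ) : Measure ℂ :=
  complexGaussian (limVarRe t k) (limVarIm t k)

instance isGaussian_limitLaw (t : ℝ) (k : ℕ) : IsGaussian (limitLaw t k) :=
  isGaussian_complexGaussian _ _

theorem integral_id_limitLaw (t : ℝ) (k : ℕ) : ∫ z, z ∂limitLaw t k = 0 :=
  integral_id_complexGaussian _ _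

theorem charFun_limitLaw_zero (t : ℝ) (ξ : ℂ) : charFun (limitLaw t 0) ξ = 1 := by
  simp [limitLaw, charFun_complexGaussian, limVarRe, limVarIm]

variable {t : ℝ} (ht : t ∈ Set.Icc (-1 : ℝ) 1)

section Moments

include ht

theorem abs_pow_le_one (k : ℕ) : |t ^ k| ≤ 1 :=
  (abs_pow t k).trans_le (pow_le_one₀ (abs_nonneg t) (abs_le.2 ht))

theorem coe_limVarRe (k : ℕ) : (limVarRe t k : ℝ) = k * (1 + t ^ k) / 2 :=
  Real.coe_toNNReal _ (div_nonneg (mul_nonneg k.cast_nonneg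
    (by linarith [(abs_le.1 (abs_pow_le_one ht k)).1])) zero_le_two)

theorem coe_limVarIm (k : ℕ) : (limVarIm t k : ℝ) = k * (1 - t ^ k) / 2 :=
  Real.coe_toNNReal _ (div_nonneg (mul_nonneg k.cast_nonneg
    (by linarith [(abs_le.1 (abs_pow_le_one ht k)).2])) zero_le_two)

theorem integral_sq_limitLaw (k : ℕ) : ∫ z, z ^ 2 ∂limitLaw t k = (k : ℂ) * (t : ℂ) ^ k := by
  rw [limitLaw, integral_sq_complexGaussian, coe_limVarRe ht, coe_limVarIm ht]
  push_cast
  ring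

theorem integral_norm_sq_limitLaw (k : ℕ) : ∫ z, ‖z‖ ^ 2 ∂limitLaw t k = k := by
  rw [limitLaw, integral_norm_sq_complexGaussian, coe_limVarRe ht, coe_limVarIm ht]
  ring

theorem charFun_limitLaw_succ (ξ : ℕ → ℂ) (k : ℕ) :
    charFun (limitLaw t (k + 1)) (ξ (k + 1)) =
      Complex.exp (-((∑ ε, ∑ δ, dualCoeff ξ (ε, k) * dualCoeff ξ (δ, k) *
        ((k + 1) * ellCov t ε δ ^ (k + 1))) / 2)) := by
  have hconj (x y : ℝ) : starRingEnd ℂ ⟨x, y⟩ = x - y * Complex.I :=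
    Complex.ext (by simp) (by simp)
  simp only [limitLaw, charFun_complexGaussian, coe_limVarRe ht, coe_limVarIm ht, Fintype.sum_bool,
    dualCoeff, ellCov, if_true, Bool.false_eq_true, reduceCtorEq, if_false, one_pow]
  congr 1
  obtain ⟨x, y⟩ := ξ (k + 1)
  dsimp only
  rw [hconj, Complex.mk_eq_add_mul_I]
  push_cast
  linear_combination ((k + 1) * (y : ℂ) ^ 2 / 4 * (t ^ (k + 1) - 1)) * Complex.I_sq

theorem exp_neg_sum_dualCoeff (ξ : ℕ → ℂ) (m : ℕ) :
    Complex.exp (-((∑ k ∈ range m, ∑ ε, ∑ δ, dualCoeff ξ (ε, k) * dualCoeff ξ (δ, k) *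
        ((k + 1) * ellCov t ε δ ^ (k + 1))) / 2)) =
      ∏ k ∈ range m, charFun (limitLaw t (k + 1)) (ξ (k + 1)) := by
  simp only [charFun_limitLaw_succ ht, ← Complex.exp_sum, sum_neg_distrib, sum_div]

end Moments

theorem realEval_sum_dualCoeff_smul_fluctTrace (ξ : ℕ → ℂ) (m n : ℕ) (g : EllIndex n → ℝ) :
    realEval g ((∑ i ∈ univ ×ˢ range m,
        dualCoeff ξ i • fluctTrace ((ellipticModel ht).chebyshevT i.1 (i.2 + 1))) n) =
      ((∑ k ∈ range (m + 1), inner ℝ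
        (realEval g (fluctTrace ((ellipticModel ht).chebyshevT true k) n)) (ξ k) : ℝ) : ℂ) := by
  have hstar (k : ℕ) : realEval g (fluctTrace ((ellipticModel ht).chebyshevT false k) n) =
      star (realEval g (fluctTrace ((ellipticModel ht).chebyshevT true k) n)) := by
    rw [← realEval_star, ← Pi.star_apply, star_fluctTrace, GaussianMatrixModel.star_chebyshevT]
    rfl
  simp only [sum_range_succ' _ m, GaussianMatrixModel.fluctTrace_chebyshevT_zero, Pi.zero_apply,
    map_zero, inner_zero_left, add_zero, Complex.ofReal_sum, inner_eq_dualCoeff, ← hstar,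
    sum_product_right, Fintype.sum_bool, Finset.sum_apply, Pi.smul_apply, map_sum,
    map_add, map_smul, smul_eq_mul]

theorem tendsto_integral_exp_inner_fluctTrace (ξ : ℕ → ℂ) (m : ℕ) :
    Tendsto (fun n => ∫ g, Complex.exp (((∑ k ∈ range m, inner ℝ
        (realEval g (fluctTrace ((ellipticModel ht).chebyshevT true k) n)) (ξ k) : ℝ) : ℂ) *
          Complex.I) ∂stdGaussianPi (EllIndex n))
      atTop (nhds (∏ k ∈ range m, charFun (limitLaw t k) (ξ k))) := by
  cases m with
  | zero => simp
  | succ m =>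
    have hreal := realEval_sum_dualCoeff_smul_fluctTrace ht ξ m
    have hphase (n : ℕ) (x : ℝ) : IsPhase ((Complex.I * x) • (∑ i ∈ univ ×ˢ range m,
        dualCoeff ξ i • fluctTrace ((ellipticModel ht).chebyshevT i.1 (i.2 + 1))) n) := fun g => by
      rw [map_smul, hreal, smul_eq_mul, mul_assoc, ← Complex.ofReal_mul, Complex.I_mul_re,
        Complex.ofReal_im, neg_zero]
    rw [prod_range_succ', charFun_limitLaw_zero, mul_one, ← exp_neg_sum_dualCoeff ht]
    refine ((ellipticModel ht).tendsto_phaseIntegral_fluctTrace_chebyshevT (dualCoeff ξ) m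
      hphase).congr fun n => ?_
    simp only [phaseIntegral_apply, map_one, one_mul, map_smul, hreal, smul_eq_mul,
      Complex.ofReal_one, mul_comm Complex.I]

include ht in
theorem tendsto_map_centredTrace_ellipticSample {μ : ℕ → ProbabilityMeasure (ℕ → ℂ)}
    (hμ : ∀ n, (μ n : Measure (ℕ → ℂ)) = (stdGaussianPi (EllIndex n)).map fun g k =>
      centredTrace (stdGaussianPi (EllIndex n)) n t (ellipticSample t n) k g) :
    Tendsto μ atTop (nhds ⟨Measure.infinitePi (limitLaw t), inferInstance⟩) := by
  refine tendsto_infinitePi_of_tendsto_charFun fun m ξ => ?_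
  refine (tendsto_integral_exp_inner_fluctTrace ht ξ m).congr fun n => ?_
  have hmeas : Measurable fun (g : EllIndex n → ℝ) k =>
      realEval g (fluctTrace ((ellipticModel ht).chebyshevT true k) n) :=
    measurable_pi_lambda _ fun k => (continuous_realEval _).measurable
  have hexp : Continuous fun x : ℕ → ℂ =>
      Complex.exp (((∑ k ∈ range m, inner ℝ (x k) (ξ k) : ℝ) : ℂ) * Complex.I) := by fun_prop
  simp only [hμ, centredTrace_ellipticSample ht]
  rw [integral_map hmeas.aemeasurable hexp.measurable.aestronglyMeasurable]

include ht in
theorem tendstoInDistribution_centredTrace {Ω : ℕ → Type*} [∀ n, MeasurableSpace (Ω n)]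
    {P : (n : ℕ) → Measure (Ω n)} [∀ n, IsProbabilityMeasure (P n)]
    {A : (n : ℕ) → Ω n → Matrix (Fin n) (Fin n) ℂ}
    (hA : ∀ n, HasLaw (A n) (ellipticGinibreLaw n t) (P n)) :
    TendstoInDistribution (E := ℕ → ℂ) (fun n ω k => centredTrace (P n) n t (A n) k ω) atTop
      (fun ω k => ω k) P (Measure.infinitePi (limitLaw t)) := by
  have hident (n : ℕ) := identDistrib_centredTrace
    ((hA n).identDistrib (hasLaw_ellipticSample t n)) t
  refine ⟨fun n => (hident n).aemeasurable_fst, aemeasurable_id, ?_⟩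
  simp only [Measure.map_id']
  exact tendsto_map_centredTrace_ellipticSample ht fun n => (hident n).map_eq

end LimitLaw

theorem mainTheorem6_general (t : ℝ) (ht : t ∈ Set.Icc (-1 : ℝ) 1)
    {Ω : ℕ → Type*} [∀ n, MeasurableSpace (Ω n)]
    (P : (n : ℕ) → Measure (Ω n)) [∀ n, IsProbabilityMeasure (P n)]
    (A : (n : ℕ) → Ω n → Matrix (Fin n) (Fin n) ℂ)
    (hA : ∀ n, HasLaw (A n) (ellipticGinibreLaw n t) (P n)) :
    (∀ n k, Integrable (fun ω => traceStat n t k (A n ω)) (P n)) ∧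
    ∃ (Ω' : Type) (_ : MeasurableSpace Ω') (P' : Measure Ω') (_ : IsProbabilityMeasure P')
      (V : ℕ → Ω' → ℂ),
      iIndepFun V P' ∧
      (∀ k, HasGaussianLaw (V k) P') ∧
      (∀ k, ∫ ω, V k ω ∂P' = 0) ∧
      (∀ k, ∫ ω, V k ω ^ 2 ∂P' = (k : ℂ) * (t : ℂ) ^ k) ∧
      (∀ k, ∫ ω, ‖V k ω‖ ^ 2 ∂P' = (k : ℝ)) ∧
      TendstoInDistribution (E := ℕ → ℂ)
        (fun n ω k => centredTrace (P n) n t (A n) k ω) atTop (fun ω k => V k ω) P P' := by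
  have hV (k : ℕ) : HasLaw (fun ω : ℕ → ℂ => ω k) (limitLaw t k)
      (Measure.infinitePi (limitLaw t)) := (measurePreserving_eval_infinitePi _ k).hasLaw
  refine ⟨fun n k => ?_, ℕ → ℂ, inferInstance, Measure.infinitePi (limitLaw t), inferInstance,
    fun k ω => ω k, iIndepFun_infinitePi (X := fun _ z => z) fun _ => measurable_id,
    fun k => (hV k).hasGaussianLaw, fun k => ?_, fun k => ?_, fun k => ?_,
    tendstoInDistribution_centredTrace ht hA⟩
  · exact ((hA n).map_eq ▸ integrable_traceStat ht n k).comp_aemeasurable (hA n).aemeasurable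
  · exact ((hV k).integral_comp (f := fun z => z) (by fun_prop)).trans (integral_id_limitLaw t k)
  · exact ((hV k).integral_comp (f := fun z => z ^ 2) (by fun_prop)).trans
      (integral_sq_limitLaw ht k)
  · exact ((hV k).integral_comp (f := fun z => ‖z‖ ^ 2) (by fun_prop)).trans
      (integral_norm_sq_limitLaw ht k)

theorem mainTheorem6 (t : ℝ) (ht : t ∈ Set.Icc (0 : ℝ) 1)
    {Ω : ℕ → Type*} [∀ n, MeasurableSpace (Ω n)]
    (P : (n : ℕ) → Measure (Ω n)) [∀ n, IsProbabilityMeasure (P n)]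
    (A : (n : ℕ) → Ω n → Matrix (Fin n) (Fin n) ℂ)
    (hA : ∀ n, HasLaw (A n) (ellipticGinibreLaw n t) (P n)) :
    (∀ n k, Integrable (fun ω => traceStat n t k (A n ω)) (P n)) ∧
    ∃ (Ω' : Type) (_ : MeasurableSpace Ω') (P' : Measure Ω') (_ : IsProbabilityMeasure P')
      (V : ℕ → Ω' → ℂ),
      iIndepFun V P' ∧
      (∀ k, HasGaussianLaw (V k) P') ∧
      (∀ k, ∫ ω, V k ω ∂P' = 0) ∧
      (∀ k, ∫ ω, V k ω ^ 2 ∂P' = (k : ℂ) * (t : ℂ) ^ k) ∧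
      (∀ k, ∫ ω, ‖V k ω‖ ^ 2 ∂P' = (k : ℝ)) ∧
      TendstoInDistribution (E := ℕ → ℂ)
        (fun n ω k => centredTrace (P n) n t (A n) k ω) atTop (fun ω k => V k ω) P P' :=
  mainTheorem6_general t ⟨by linarith [ht.1], ht.2⟩ P A hA
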